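/- **Setting.** $N$ sources share a channel on which each packet transmission succeeds independently with probability $p\in(0,1]$. An update of source $j$ consists of $L_j\ge 1$ packets, and source $j$ has weight $\alpha_j>0$. When source $j$ is scheduled at a decision instant, with probability $1-p$ its first packet fails and the stage ends after one slot; with probability $p$ the first packet succeeds and the stage lasts $l$ slots with probability $p^{(j)}_l$, until the whole update is delivered. Here $p^{(j)}_1=1$ if $L_j=1$, and if $L_j\ge 2$ then $p^{(j)}_l=\binom{l-2}{L_j-2}p^{L_j-1}(1-p)^{l-L_j}$ for $l\ge L_j$ and $p^{(j)}_l=0$ for $l<L_j$. Fix two distinct sources $i\ne m$ and a multiplier $\lambda\in\mathbb R$. In the two-action problem of source $i$ the state is the age $v\in\mathbb Z_{\ge0}$ of source $i$, and the action is the scheduled source $j\in\{i,m\}$. After a stage of length $l$ the age becomes $l$ if an update of $i$ was delivered, and $v+l$ otherwise. A stage costs the sum of $\alpha_i\cdot(\text{age of }i)$ over its slots; its expectation is $g_i(v,\mathbf e_j)=\alpha_i\bigl(vL_j+w(L_j)\bigr)$ with $w(L)=L(L-1)/(2p)$. If $j=i$, there is an additional charge of $\lambda$ times the expected stage length $L_i$.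 The long-run average cost of a stationary policy is the $\limsup_{K\to\infty}$ of the expected cost of stages $0,\dots,K$ divided by their expected total length, and the optimal average cost $\theta(\lambda)$ is the infimum over stationary (deterministic) policies. The two-action Bellman equation is $$h_i(v)=(1-p)\,h_i(v+1)+\min\{Q_{i,i}(v),\,Q_{i,m}(v)\},\qquad v\in\mathbb Z_{\ge 0},$$ $$Q_{i,i}(v)=g_i(v,\mathbf e_i)+(\lambda-\theta(\lambda))L_i+\sum_{l\ge L_i}p\,p^{(i)}_l\,h_i(l),$$ $$Q_{i,m}(v)=g_i(v,\mathbf e_m)-\theta(\lambda)L_m+\sum_{l\ge L_m}p\,p^{(m)}_l\,h_i(v+l),$$ where a solution $h_i$ is required to grow at most linearly in $v$, like the stage cost. **Theorem (Threshold structure and characterization).** The optimal average cost $\theta(\lambda)$ is finite and does not depend on the initial age, and the Bellman equation has a solution. The optimal policy is of threshold type, with the threshold $T_i(\lambda)\in\mathbb Z_{\ge0}$ given by $$T_i(\lambda)=\max\Bigl\{0,\ \Bigl\lceil \frac{\theta(\lambda)}{\alpha_i}-\frac{L_m-1}{2p}-\frac{L_i}{p}\Bigr\rceil\Bigr\}.$$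 That is: 1. For every solution $h_i$ of the Bellman equation and every $v\ge L_i$, scheduling $m$ is strictly better if $v<T_i(\lambda)$ (that is, $Q_{i,m}(v)<Q_{i,i}(v)$), and scheduling $i$ is optimal if $v\ge T_i(\lambda)$ (that is, $Q_{i,i}(v)\le Q_{i,m}(v)$). 2. Every stationary policy with actions in $\{i,m\}$ that schedules $m$ when $L_i\le v<T_i(\lambda)$ and $i$ when $v\ge L_i$ and $v\ge T_i(\lambda)$ is average-cost optimal from every initial age: its average cost equals $\theta(\lambda)$, and is attained as a limit. -/

import Mathlib

/-- `N` sources sharing an unreliable channel. Every packet transmission succeeds with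
probability `p`; an update of source `j` consists of `L j` packets; `α j` is the positive weight
of the age of source `j`. -/
structure UpdateSystem (N : ℕ) where
  p : ℝ
  p_pos : 0 < p
  p_le_one : p ≤ 1
  L : Fin N → ℕ
  one_le_L : ∀ j, 1 ≤ L j
  α : Fin N → ℝ
  α_pos : ∀ j, 0 < α j

namespace UpdateSystem

variable {N : ℕ} (S : UpdateSystem N)

/-- The probability `p_l^{(j)}` that an update of source `j` takes exactly `l` slots, counted from
the slot in which its first packet is successfully transmitted. -/
noncomputable def deliveryProb (j : Fin N) (l : ℕ) : ℝ :=
  if S.L j = 1 then (if l = 1 then 1 else 0)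
  else if S.L j ≤ l then
    ((l - 2).choose (S.L j - 2) : ℝ) * S.p ^ (S.L j - 1) * (1 - S.p) ^ (l - S.L j)
  else 0

theorem deliveryProb_nonneg (j : Fin N) (l : ℕ) : 0 ≤ S.deliveryProb j l := by
  have h1 := S.p_pos
  have h2 : 0 ≤ 1 - S.p := sub_nonneg.2 S.p_le_one
  unfold deliveryProb
  split_ifs <;> positivity

theorem hasSum_deliveryProb (j : Fin N) : HasSum (S.deliveryProb j) 1 := by
  have h1 := S.p_pos
  have h2 := S.p_le_one
  by_cases hL : S.L j = 1
  · have : S.deliveryProb j = fun l => if l = 1 then (1 : ℝ) else 0 := by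
      funext l; simp [deliveryProb, hL]
    rw [this]
    exact hasSum_ite_eq 1 1
  · obtain ⟨k, hk⟩ : ∃ k, S.L j = k + 2 :=
      ⟨S.L j - 2, by have := S.one_le_L j; omega⟩
    have hr : ‖1 - S.p‖ < 1 := by
      rw [Real.norm_eq_abs, abs_lt]; constructor <;> linarith
    have hs := (hasSum_choose_mul_geometric_of_norm_lt_one k hr).mul_right (S.p ^ (k + 1))
    have e1 : 1 / (1 - (1 - S.p)) ^ (k + 1) * S.p ^ (k + 1) = 1 := by
      have : S.p ^ (k + 1) ≠ 0 := by positivity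
      rw [sub_sub_cancel]; field_simp
    rw [e1] at hs
    have hinj : Function.Injective (fun n : ℕ => n + (k + 2)) := add_left_injective _
    refine (hinj.hasSum_iff ?_).1 ?_
    · intro l hl
      have : ¬ k + 2 ≤ l := fun h => hl ⟨l - (k + 2), by simp; omega⟩
      simp [deliveryProb, hk, this]
    · refine hs.congr_fun ?_
      intro n
      have e2 : n + (k + 2) - 2 = n + k := by omega
      have e3 : k + 2 - 1 = k + 1 := by omega
      simp [deliveryProb, hk, e2]
      ring

/-- Law of the number of slots that an update of source `j` takes, counted from the slot in which
its first packet is successfully transmitted. -/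
noncomputable def delivery (j : Fin N) : PMF ℕ :=
  ⟨fun l => ENNReal.ofReal (S.deliveryProb j l), by
    have h := ENNReal.ofReal_tsum_of_nonneg (S.deliveryProb_nonneg j)
      (S.hasSum_deliveryProb j).summable
    rw [(S.hasSum_deliveryProb j).tsum_eq, ENNReal.ofReal_one] at h
    rw [h]
    exact ENNReal.summable.hasSum⟩

/-- Law of the success of the first packet: `true` with probability `p`. -/
noncomputable def firstPacket : PMF Bool :=
  PMF.ofFintype (fun b => ENNReal.ofReal (if b then S.p else 1 - S.p)) (by
    simp [← ENNReal.ofReal_add S.p_pos.le (sub_nonneg.2 S.p_le_one)])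

/-- Law of the outcome of a decision stage in which source `j` is scheduled: whether the first
packet got through, and the length of the stage in slots. After a failure of the first packet the
stage ends after one slot; otherwise it lasts until the whole update has been delivered. -/
noncomputable def stage (j : Fin N) : PMF (Bool × ℕ) :=
  S.firstPacket.bind fun s =>
    if s then (S.delivery j).map fun l => (true, l) else PMF.pure (false, 1)

/-- Expectation of a real function of a discrete random variable. -/
noncomputable def expect {β : Type*} (μ : PMF β) (f : β → ℝ) : ℝ :=
  ∑' b, (μ b).toReal * f b

/-- Age of source `i` at the end of a stage with outcome `o` in which source `j` was scheduled,
if its age was `v` at the beginning of the stage. -/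
def nextAge (i j : Fin N) (v : ℕ) (o : Bool × ℕ) : ℕ :=
  if o.1 = true ∧ j = i then o.2 else v + o.2

/-- Expected length of a stage in which source `j` is scheduled. -/
noncomputable def meanDuration (j : Fin N) : ℝ :=
  expect (S.stage j) fun o => (o.2 : ℝ)

/-- Expected weighted age of source `i` accumulated over the slots of a stage that starts with age
`v` and in which source `j` is scheduled. -/
noncomputable def ageCost (i j : Fin N) (v : ℕ) : ℝ :=
  expect (S.stage j) fun o => S.α i * ∑ s ∈ Finset.range o.2, ((v : ℝ) + (s : ℝ))

/-- Expected cost of a stage in the problem of source `i` with multiplier `lam`: every slot of a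
stage in which source `i` itself is scheduled is charged an additional `lam`. -/
noncomputable def stageCost (lam : ℝ) (i j : Fin N) (v : ℕ) : ℝ :=
  S.ageCost i j v + if j = i then lam * S.meanDuration i else 0

/-- Law of the age of source `i` at the `k`-th decision instant, under the stationary policy `π`
and with initial age `v₀`. -/
noncomputable def ageLaw (i : Fin N) (π : ℕ → Fin N) (v₀ : ℕ) : ℕ → PMF ℕ
  | 0 => PMF.pure v₀
  | k + 1 => (ageLaw i π v₀ k).bind fun v => (S.stage (π v)).map (nextAge i (π v) v)

/-- Expected cost of the stages `0, …, K` divided by their expected total length. -/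
noncomputable def costRatio (lam : ℝ) (i : Fin N) (π : ℕ → Fin N) (v₀ K : ℕ) : ℝ :=
  (∑ k ∈ Finset.range (K + 1),
      expect (S.ageLaw i π v₀ k) fun v => S.stageCost lam i (π v) v) /
    ∑ k ∈ Finset.range (K + 1),
      expect (S.ageLaw i π v₀ k) fun v => S.meanDuration (π v)

/-- Long-run average cost per slot of the stationary policy `π` (possibly `+∞`). -/
noncomputable def averageCost (lam : ℝ) (i : Fin N) (π : ℕ → Fin N) (v₀ : ℕ) : EReal :=
  Filter.limsup (fun K => ((S.costRatio lam i π v₀ K : ℝ) : EReal)) Filter.atTop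

/-- Stationary policies that schedule only `i` or `m`. -/
def twoActionPolicies (i m : Fin N) : Set (ℕ → Fin N) :=
  {π | ∀ v, π v = i ∨ π v = m}

/-- Optimal average cost of the two-action problem, from the initial age `v₀`. -/
noncomputable def optimalCost (lam : ℝ) (i m : Fin N) (v₀ : ℕ) : EReal :=
  ⨅ π ∈ twoActionPolicies i m, S.averageCost lam i π v₀

/-- `w(L_j) = L_j (L_j - 1) / (2 p)`. -/
noncomputable def w (j : Fin N) : ℝ :=
  (S.L j : ℝ) * ((S.L j : ℝ) - 1) / (2 * S.p)

/-- `g_i(v, e_j) = α_i (v L_j + w(L_j))`. -/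
noncomputable def g (i j : Fin N) (v : ℕ) : ℝ :=
  S.α i * ((v : ℝ) * S.L j + S.w j)

/-- `Q_{i,i}(v)`, the action-dependent part of the Bellman equation when `i` is scheduled. -/
noncomputable def QSelf (lam θ : ℝ) (h : ℕ → ℝ) (i : Fin N) (v : ℕ) : ℝ :=
  S.g i i v + (lam - θ) * S.L i + ∑' l, S.p * S.deliveryProb i l * h l

/-- `Q_{i,j}(v)` for `j ≠ i`, the action-dependent part when `j` is scheduled. -/
noncomputable def QOther (θ : ℝ) (h : ℕ → ℝ) (i j : Fin N) (v : ℕ) : ℝ :=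
  S.g i j v - θ * S.L j + ∑' l, S.p * S.deliveryProb j l * h (v + l)

/-- `h` is a relative value function of the two-action problem with average cost `θ`: it solves
the Bellman equation at every age, and it grows at most linearly, as the stage cost does. -/
def IsRelativeValue (lam θ : ℝ) (i m : Fin N) (h : ℕ → ℝ) : Prop :=
  (∀ v, h v = (1 - S.p) * h (v + 1) + min (S.QSelf lam θ h i v) (S.QOther θ h i m v)) ∧
    ∃ C : ℝ, ∀ v : ℕ, |h v| ≤ C * (1 + (v : ℝ))

end UpdateSystem

/-!
Let `a = α i * L i / p` and let `x = θ / α i - (L m - 1) / (2 p) - L i / p` be the indifference age.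
Always scheduling `i` has an affine relative value of slope `a`. Write a solution `h` of the Bellman
equation as `h v = a v + b + D v`, with `b` chosen such that the affine part is the value of always
scheduling `i` when the expected relative value after an update is the one of `h`. The computation
`QOther_eq_QSelf_add_gap` gives
`QOther v - QSelf v = α i * L m * (v - x) + ∑ l, successProb m l * D (v + l)`,
so that the Bellman equation becomes `D v = (1 - p) * D (v + 1) + min 0 (gap v)` (`bellman_iff`).

*Threshold* (`IsRelativeValue.threshold`). The recursion gives `D v ≤ (1 - p) * D (v + 1)`, and
linear growth forces `D ≤ 0`; hence `m` is strictly better below `x`. Conversely `-D` is subharmonic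
up to the linear running cost `α i * L m * (v - x)`. This cost lowers the slope of any linear bound on
`-D` until `-D` is bounded; then `-D` vanishes at large ages, and, going back, at all ages from `x` on
(`nonpos_of_subharmonic`). There the gap is nonnegative. This works for every real `θ`.

*Existence* (`exists_isRelativeValue`). For given `θ` the recursion for `D` is solved backwards from
a large age. The solution is continuous in `θ`, and the one remaining condition, that the expected
relative value after an update of `i` is the one that enters `QSelf`, is a scalar equation in `θ`
that the intermediate value theorem solves.

*Verification* (`le_averageCost`, `tendsto_costRatio`). Along any two-action policy the Bellman
equation telescopes to an inequality between the accumulated costs, `θ` times the accumulated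
lengths and the expected relative value at the end, with equality from stage `L i` on for a threshold
policy, because ages below `L i` are transient. Under a threshold policy the mean age is bounded and
the cost ratio converges to `θ`. A policy with average cost below `θ` would need a relative value,
hence a mean age, that tends to infinity; but then its stage costs tend to infinity as well.
-/

/-! ### Expectations of functions of discrete random variables -/

theorem HasSum.of_eq {f g : ℕ → ℝ} {a b : ℝ} (h : HasSum f a) (hfg : ∀ l, g l = f l)
    (hab : b = a) : HasSum g b := by
  rw [funext hfg, hab]; exact h

namespace UpdateSystem

section Expectation

variable {β γ : Type*}

/-- The expectation of `f` under `μ` exists (absolutely), so that `expect μ f` is not a junk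
value. -/
def Expectable (μ : PMF β) (f : β → ℝ) : Prop :=
  Summable fun b => (μ b).toReal * f b

theorem hasSum_toReal (μ : PMF β) : HasSum (fun b => (μ b).toReal) 1 := by
  have h1 : Summable fun b => (μ b).toReal := ENNReal.summable_toReal μ.tsum_coe_ne_top
  have h2 : ∑' b, (μ b).toReal = 1 := by
    rw [← ENNReal.tsum_toReal_eq μ.apply_ne_top, μ.tsum_coe, ENNReal.toReal_one]
  exact h2 ▸ h1.hasSum

theorem expectable_const (μ : PMF β) (c : ℝ) : Expectable μ fun _ => c :=
  (hasSum_toReal μ).summable.mul_right c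

theorem expect_const (μ : PMF β) (c : ℝ) : expect μ (fun _ => c) = c := by
  simpa [expect] using ((hasSum_toReal μ).mul_right c).tsum_eq

theorem Expectable.add {μ : PMF β} {f g : β → ℝ} (hf : Expectable μ f) (hg : Expectable μ g) :
    Expectable μ fun b => f b + g b := by
  simpa only [Expectable, mul_add] using Summable.add hf hg

theorem expect_add {μ : PMF β} {f g : β → ℝ} (hf : Expectable μ f) (hg : Expectable μ g) :
    expect μ (fun b => f b + g b) = expect μ f + expect μ g := by
  simpa only [expect, mul_add] using Summable.tsum_add hf hg

theorem Expectable.const_mul {μ : PMF β} {f : β → ℝ} (c : ℝ) (hf : Expectable μ f) :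
    Expectable μ fun b => c * f b := by
  simpa only [Expectable, mul_left_comm] using Summable.mul_left c hf

theorem expect_const_mul {μ : PMF β} {f : β → ℝ} (c : ℝ) :
    expect μ (fun b => c * f b) = c * expect μ f := by
  simp only [expect, mul_left_comm _ c, tsum_mul_left]

theorem Expectable.abs {μ : PMF β} {f : β → ℝ} (hf : Expectable μ f) :
    Expectable μ fun b => |f b| := by
  simpa [Expectable, abs_mul] using Summable.abs hf

/-- Only the values on the support of `μ` matter. -/
theorem expect_mono {μ : PMF β} {f g : β → ℝ} (hf : Expectable μ f) (hg : Expectable μ g)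
    (h : ∀ b, μ b ≠ 0 → f b ≤ g b) : expect μ f ≤ expect μ g := by
  refine Summable.tsum_le_tsum (fun b => ?_) hf hg
  by_cases hb : μ b = 0
  · simp [hb]
  · exact mul_le_mul_of_nonneg_left (h b hb) ENNReal.toReal_nonneg

theorem expect_congr {μ : PMF β} {f g : β → ℝ} (h : ∀ b, μ b ≠ 0 → f b = g b) :
    expect μ f = expect μ g := by
  refine tsum_congr fun b => ?_
  by_cases hb : μ b = 0
  · simp [hb]
  · rw [h b hb]

theorem hasSum_pure (b : β) (f : β → ℝ) :
    HasSum (fun x => (PMF.pure b x).toReal * f x) (f b) := by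
  classical
  have := hasSum_single (f := fun x => (PMF.pure b x).toReal * f x) b
    (fun x hx => by simp [PMF.pure_apply, hx])
  simpa [PMF.pure_apply] using this

theorem expectable_pure (b : β) (f : β → ℝ) : Expectable (PMF.pure b) f :=
  (hasSum_pure b f).summable

theorem expect_pure (b : β) (f : β → ℝ) : expect (PMF.pure b) f = f b :=
  (hasSum_pure b f).tsum_eq

theorem hasSum_toReal_bind (μ : PMF γ) (κ : γ → PMF β) (b : β) :
    HasSum (fun a => (μ a).toReal * (κ a b).toReal) (μ.bind κ b).toReal := by
  have hne : ∑' a, μ a * κ a b ≠ ⊤ := by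
    rw [← PMF.bind_apply]; exact PMF.apply_ne_top _ _
  have h1 := ENNReal.summable_toReal hne
  have h2 := ENNReal.tsum_toReal_eq (ENNReal.ne_top_of_tsum_ne_top hne)
  rw [PMF.bind_apply, h2]
  simpa only [ENNReal.toReal_mul] using h1.hasSum

/-- The law of total expectation, with the domination that makes both sides meaningful. -/
theorem expect_bind {μ : PMF γ} {κ : γ → PMF β} {f : β → ℝ}
    (hκ : ∀ a, Expectable (κ a) f)
    (hμ : Expectable μ fun a => expect (κ a) fun b => |f b|) :
    Expectable (μ.bind κ) f ∧
      expect (μ.bind κ) f = expect μ fun a => expect (κ a) f := by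
  obtain ⟨F, hF⟩ : ∃ F : γ × β → ℝ, ∀ a b, F (a, b) = (μ a).toReal * ((κ a b).toReal * f b) :=
    ⟨fun z => (μ z.1).toReal * ((κ z.1 z.2).toReal * f z.2), fun _ _ => rfl⟩
  have hrow : ∀ a, Summable fun b => F (a, b) := by
    intro a
    simp only [hF]
    exact Summable.mul_left _ (hκ a)
  have hFs : Summable F := by
    refine Summable.of_norm ?_
    refine (summable_prod_of_nonneg (fun _ => norm_nonneg _)).2 ⟨fun a => (hrow a).norm, ?_⟩
    have hrow' : (fun a => ∑' b, ‖F (a, b)‖) =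
        fun a => (μ a).toReal * expect (κ a) fun b => |f b| := by
      funext a
      rw [expect, ← tsum_mul_left]
      refine tsum_congr fun b => ?_
      rw [hF, Real.norm_eq_abs, abs_mul, abs_mul, ENNReal.abs_toReal, ENNReal.abs_toReal]
    rw [hrow']
    exact hμ
  have hswap : HasSum (fun z : β × γ => F (z.2, z.1)) (∑' z, F z) :=
    (Equiv.prodComm β γ).hasSum_iff.2 hFs.hasSum
  have h3 : HasSum (fun b => (μ.bind κ b).toReal * f b) (∑' z, F z) := by
    refine hswap.prod_fiberwise fun b => ?_
    have := (hasSum_toReal_bind μ κ b).mul_right (f b)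
    simp only [hF, ← mul_assoc]
    exact this
  refine ⟨h3.summable, ?_⟩
  rw [expect, h3.tsum_eq, hFs.tsum_prod, expect]
  refine tsum_congr fun a => ?_
  simp only [hF]
  rw [tsum_mul_left, expect]

theorem expect_map {μ : PMF γ} {g : γ → β} {f : β → ℝ} (h : Expectable μ fun a => f (g a)) :
    Expectable (μ.map g) f ∧ expect (μ.map g) f = expect μ fun a => f (g a) := by
  have := expect_bind (μ := μ) (κ := fun a => PMF.pure (g a)) (f := f)
    (fun a => expectable_pure _ _) (by simpa only [expect_pure] using h.abs)
  simp only [expect_pure] at this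
  exact this

end Expectation

/-! ### Moments of the length of a stage -/

variable {N : ℕ} (S : UpdateSystem N)

theorem deliveryProb_eq_zero {j : Fin N} {l : ℕ} (h : l < S.L j) : S.deliveryProb j l = 0 := by
  have := S.one_le_L j
  unfold deliveryProb
  split_ifs <;> first | rfl | omega

/-- After the first success, `L j - 1` more packets are needed, so `l - 1` has a negative binomial
law; the moments come from the binomial series of higher orders. -/
theorem hasSum_deliveryProb_moments (j : Fin N) :
    HasSum (fun l : ℕ => S.deliveryProb j l * ((l : ℝ) - 1)) (((S.L j : ℝ) - 1) / S.p) ∧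
    HasSum (fun l : ℕ => S.deliveryProb j l * ((l : ℝ) * ((l : ℝ) - 1)))
      ((S.L j : ℝ) * ((S.L j : ℝ) - 1) / S.p ^ 2) := by
  have h1 := S.p_pos
  have h2 := S.p_le_one
  by_cases hL : S.L j = 1
  · constructor
    · convert hasSum_zero using 1
      · funext l
        by_cases hl : l = 1 <;> simp [deliveryProb, hL, hl]
      · simp [hL]
    · convert hasSum_zero using 1
      · funext l
        by_cases hl : l = 1 <;> simp [deliveryProb, hL, hl]
      · simp [hL]
  · obtain ⟨k, hk⟩ : ∃ k, S.L j = k + 2 :=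
      ⟨S.L j - 2, by have := S.one_le_L j; omega⟩
    have hr : ‖1 - S.p‖ < 1 := by
      rw [Real.norm_eq_abs, abs_lt]; constructor <;> linarith
    have hinj : Function.Injective (fun n : ℕ => n + (k + 2)) := add_left_injective _
    have hout : ∀ l ∉ Set.range (fun n : ℕ => n + (k + 2)), S.deliveryProb j l = 0 := by
      intro l hl
      refine S.deliveryProb_eq_zero ?_
      by_contra hc
      exact hl ⟨l - (k + 2), by simp; omega⟩
    have hval : ∀ n : ℕ, S.deliveryProb j (n + (k + 2)) =
        ((n + k).choose k : ℝ) * S.p ^ (k + 1) * (1 - S.p) ^ n := by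
      intro n
      have e2 : n + (k + 2) - 2 = n + k := by omega
      have e3 : k + 2 - 1 = k + 1 := by omega
      simp [deliveryProb, hk, e2]
    -- absorbing a factor into the binomial coefficient raises the order of the binomial series
    have c1 : ∀ n : ℕ, ((n : ℝ) + k + 1) * ((n + k).choose k : ℝ) =
        (k + 1) * ((n + (k + 1)).choose (k + 1) : ℝ) := by
      intro n
      have := Nat.add_one_mul_choose_eq (n + k) k
      have h' : (n + k + 1) * (n + k).choose k = (n + k + 1).choose (k + 1) * (k + 1) := this
      have h'' : (((n + k + 1) * (n + k).choose k : ℕ) : ℝ)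
        = (((n + k + 1).choose (k + 1) * (k + 1) : ℕ) : ℝ) := by rw [h']
      push_cast at h''
      rw [← add_assoc, h'']; ring
    have c2 : ∀ n : ℕ, ((n : ℝ) + k + 2) * ((n + (k + 1)).choose (k + 1) : ℝ) =
        (k + 2) * ((n + (k + 2)).choose (k + 2) : ℝ) := by
      intro n
      have := Nat.add_one_mul_choose_eq (n + k + 1) (k + 1)
      have h'' : (((n + k + 1 + 1) * (n + k + 1).choose (k + 1) : ℕ) : ℝ)
        = (((n + k + 1 + 1).choose (k + 1 + 1) * (k + 1 + 1) : ℕ) : ℝ) := by rw [← this]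
      push_cast at h''
      have e : n + (k + 2) = n + k + 1 + 1 := by ring
      rw [← add_assoc, e, show k + 2 = k + 1 + 1 from rfl]
      linear_combination h''
    have s1 := hasSum_choose_mul_geometric_of_norm_lt_one (k + 1) hr
    have s2 := hasSum_choose_mul_geometric_of_norm_lt_one (k + 2) hr
    rw [sub_sub_cancel] at s1 s2
    constructor
    · refine (hinj.hasSum_iff fun l hl => by rw [hout l hl, zero_mul]).1 ?_
      refine (s1.mul_right ((k + 1) * S.p ^ (k + 1))).of_eq (fun n => ?_) ?_
      · simp only [Function.comp_apply, hval]
        push_cast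
        linear_combination (S.p ^ (k + 1) * (1 - S.p) ^ n) * c1 n
      · rw [hk]; push_cast; field_simp; ring
    · refine (hinj.hasSum_iff fun l hl => by rw [hout l hl, zero_mul]).1 ?_
      refine (s2.mul_right ((k + 1) * (k + 2) * S.p ^ (k + 1))).of_eq (fun n => ?_) ?_
      · simp only [Function.comp_apply, hval]
        push_cast
        linear_combination (S.p ^ (k + 1) * (1 - S.p) ^ n) * (((n : ℝ) + k + 2) * c1 n
          + (k + 1) * c2 n)
      · rw [hk]; push_cast; field_simp; ring

/-- Probability that a stage in which source `j` is scheduled delivers an update and lasts `l`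
slots. -/
noncomputable def successProb (j : Fin N) (l : ℕ) : ℝ := S.p * S.deliveryProb j l

theorem successProb_nonneg (j : Fin N) (l : ℕ) : 0 ≤ S.successProb j l :=
  mul_nonneg S.p_pos.le (S.deliveryProb_nonneg j l)

theorem successProb_eq_zero {j : Fin N} {l : ℕ} (h : l < S.L j) : S.successProb j l = 0 := by
  rw [successProb, S.deliveryProb_eq_zero h, mul_zero]

theorem successProb_zero (j : Fin N) : S.successProb j 0 = 0 :=
  S.successProb_eq_zero (S.one_le_L j)

theorem hasSum_successProb (j : Fin N) : HasSum (S.successProb j) S.p :=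
  ((S.hasSum_deliveryProb j).mul_left S.p).of_eq (fun _ => rfl) (mul_one _).symm

theorem hasSum_successProb_mul (j : Fin N) :
    HasSum (fun l : ℕ => S.successProb j l * l) (S.L j - 1 + S.p) := by
  have h := ((S.hasSum_deliveryProb_moments j).1.mul_left S.p).add (S.hasSum_successProb j)
  rw [mul_div_cancel₀ _ S.p_pos.ne'] at h
  refine h.congr_fun fun l => ?_
  simp only [successProb]; ring

theorem hasSum_successProb_mul_sum_range (j : Fin N) :
    HasSum (fun l : ℕ => S.successProb j l * ((l : ℝ) * ((l : ℝ) - 1) / 2)) (S.w j) := by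
  have h := (S.hasSum_deliveryProb_moments j).2.mul_left (S.p / 2)
  have hp := S.p_pos.ne'
  refine h.of_eq (fun l => ?_) ?_
  · simp only [successProb]; ring
  · rw [w]; field_simp

theorem hasSum_successProb_affine (j : Fin N) (a b : ℝ) :
    HasSum (fun l : ℕ => S.successProb j l * (a * l + b))
      (a * (S.L j - 1 + S.p) + b * S.p) := by
  have h := ((S.hasSum_successProb_mul j).mul_left a).add ((S.hasSum_successProb j).mul_left b)
  refine h.congr_fun fun l => ?_
  ring

/-- A real function of the age grows at most linearly. -/
def LinearGrowth (f : ℕ → ℝ) : Prop := ∃ C : ℝ, ∀ v : ℕ, |f v| ≤ C * (1 + (v : ℝ))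

theorem LinearGrowth.nonneg_bound {f : ℕ → ℝ} (hf : LinearGrowth f) :
    ∃ C : ℝ, 0 ≤ C ∧ ∀ v : ℕ, |f v| ≤ C * (1 + (v : ℝ)) := by
  obtain ⟨C, hC⟩ := hf
  have h0 := (abs_nonneg _).trans (hC 0)
  exact ⟨C, by simpa using h0, hC⟩

theorem LinearGrowth.add {f g : ℕ → ℝ} (hf : LinearGrowth f) (hg : LinearGrowth g) :
    LinearGrowth fun v => f v + g v := by
  obtain ⟨C, hC⟩ := hf
  obtain ⟨C', hC'⟩ := hg
  refine ⟨C + C', fun v => (abs_add_le _ _).trans ?_⟩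
  linarith [hC v, hC' v]

theorem LinearGrowth.abs {f : ℕ → ℝ} (hf : LinearGrowth f) : LinearGrowth fun v => |f v| := by
  simpa only [LinearGrowth, abs_abs] using hf

theorem LinearGrowth.const_mul {f : ℕ → ℝ} (c : ℝ) (hf : LinearGrowth f) :
    LinearGrowth fun v => c * f v := by
  obtain ⟨C, hC⟩ := hf
  refine ⟨|c| * C, fun v => ?_⟩
  rw [abs_mul, mul_assoc]
  exact mul_le_mul_of_nonneg_left (hC v) (abs_nonneg c)

theorem linearGrowth_affine (a b : ℝ) : LinearGrowth fun v : ℕ => a * v + b := by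
  refine ⟨|a| + |b|, fun v => (abs_add_le _ _).trans ?_⟩
  rw [abs_mul, Nat.abs_cast]
  have := abs_nonneg a
  have := abs_nonneg b
  have hv : (0 : ℝ) ≤ v := v.cast_nonneg
  nlinarith [mul_nonneg (abs_nonneg b) hv]

theorem linearGrowth_const (c : ℝ) : LinearGrowth fun _ => c := by
  simpa using linearGrowth_affine 0 c

theorem linearGrowth_cast : LinearGrowth fun v : ℕ => (v : ℝ) := by
  simpa using linearGrowth_affine 1 0

theorem LinearGrowth.comp_add {f : ℕ → ℝ} (hf : LinearGrowth f) (v : ℕ) :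
    LinearGrowth fun l => f (v + l) := by
  obtain ⟨C, hC0, hC⟩ := hf.nonneg_bound
  refine ⟨C * (1 + v), fun l => (hC _).trans ?_⟩
  have hv : (0 : ℝ) ≤ v := v.cast_nonneg
  have hl : (0 : ℝ) ≤ l := l.cast_nonneg
  rw [mul_assoc]
  refine mul_le_mul_of_nonneg_left ?_ hC0
  push_cast
  nlinarith [mul_nonneg hv hl]

theorem summable_successProb_mul (j : Fin N) {f : ℕ → ℝ} (hf : LinearGrowth f) :
    Summable fun l => S.successProb j l * f l := by
  obtain ⟨C, hC⟩ := hf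
  refine Summable.of_norm_bounded (S.hasSum_successProb_affine j C C).summable fun l => ?_
  rw [norm_mul, Real.norm_eq_abs, Real.norm_eq_abs, abs_of_nonneg (S.successProb_nonneg j l)]
  refine mul_le_mul_of_nonneg_left ((hC l).trans ?_) (S.successProb_nonneg j l)
  linarith

theorem toReal_stage_true (j : Fin N) (l : ℕ) :
    (S.stage j (true, l)).toReal = S.successProb j l := by
  have h1 : S.stage j (true, l) =
      ENNReal.ofReal S.p * ENNReal.ofReal (S.deliveryProb j l) := by
    classical
    rw [stage, PMF.bind_apply, tsum_bool]
    have : ((S.delivery j).map fun l => (true, l)) (true, l) = S.delivery j l := by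
      rw [PMF.map_apply]
      rw [tsum_eq_single l (fun b hb => by simp [Ne.symm hb])]
      simp
    simp only [Bool.false_eq_true, if_false, if_true, this]
    simp [firstPacket, delivery]
    rfl
  rw [h1, ENNReal.toReal_mul, ENNReal.toReal_ofReal S.p_pos.le,
    ENNReal.toReal_ofReal (S.deliveryProb_nonneg j l), successProb]

theorem toReal_stage_false (j : Fin N) (l : ℕ) :
    (S.stage j (false, l)).toReal = if l = 1 then 1 - S.p else 0 := by
  have h1 : S.stage j (false, l) = if l = 1 then ENNReal.ofReal (1 - S.p) else 0 := by
    classical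
    rw [stage, PMF.bind_apply, tsum_bool]
    simp [firstPacket, PMF.map_apply, PMF.pure_apply]
  rw [h1]
  split_ifs
  · exact ENNReal.toReal_ofReal (sub_nonneg.2 S.p_le_one)
  · rfl

theorem hasSum_stage {j : Fin N} {f : Bool × ℕ → ℝ} {s : ℝ}
    (h : HasSum (fun l => S.successProb j l * f (true, l)) s) :
    HasSum (fun o => (S.stage j o).toReal * f o) ((1 - S.p) * f (false, 1) + s) := by
  have h0 : HasSum (fun l => (S.stage j (false, l)).toReal * f (false, l))
      ((1 - S.p) * f (false, 1)) := by
    have := hasSum_single (f := fun l => (S.stage j (false, l)).toReal * f (false, l)) 1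
      (fun l hl => by simp [toReal_stage_false, hl])
    simpa [toReal_stage_false] using this
  have h1 : HasSum (fun l => (S.stage j (true, l)).toReal * f (true, l)) s := by
    simpa only [toReal_stage_true] using h
  refine (Equiv.boolProdEquivSum ℕ).symm.hasSum_iff.1 ?_
  exact HasSum.sum h0 h1

theorem meanDuration_eq (j : Fin N) : S.meanDuration j = S.L j := by
  have h := S.hasSum_stage (j := j) (f := fun o => (o.2 : ℝ)) (S.hasSum_successProb_mul j)
  rw [meanDuration, expect, h.tsum_eq]
  push_cast; ring

theorem ageCost_eq (i j : Fin N) (v : ℕ) : S.ageCost i j v = S.g i j v := by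
  have key : ∀ l : ℕ, ∑ s ∈ Finset.range l, ((v : ℝ) + (s : ℝ))
      = v * l + (l : ℝ) * ((l : ℝ) - 1) / 2 := by
    intro l
    induction l with
    | zero => simp
    | succ n ih => rw [Finset.sum_range_succ, ih]; push_cast; ring
  have h0 := ((S.hasSum_successProb_mul j).mul_left (S.α i * v)).add
    ((S.hasSum_successProb_mul_sum_range j).mul_left (S.α i))
  have h := S.hasSum_stage (j := j)
    (f := fun o => S.α i * ∑ s ∈ Finset.range o.2, ((v : ℝ) + (s : ℝ)))
    (h0.congr_fun fun l => by rw [key]; ring)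
  rw [ageCost, expect, h.tsum_eq, g]
  simp
  ring

/-! ### Comparison arguments for functions of linear growth -/

/-- A function of linear growth that is dominated by a contraction of its own shift cannot exceed
the fixed point of that contraction: the geometric factor beats the linear growth. -/
theorem le_of_le_shift {r K C : ℝ} {V : ℕ} {u : ℕ → ℝ} (hr0 : 0 ≤ r) (hr1 : r < 1)
    (hC : ∀ v : ℕ, u v ≤ C * (1 + v))
    (h : ∀ v, V ≤ v → u v ≤ r * u (v + 1) + (1 - r) * K) :
    ∀ v, V ≤ v → u v ≤ K := by
  intro v hv
  have iter : ∀ n : ℕ, u v - K ≤ r ^ n * (u (v + n) - K) := by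
    intro n
    induction n with
    | zero => simp
    | succ n ih =>
      refine ih.trans ?_
      rw [pow_succ, mul_assoc]
      refine mul_le_mul_of_nonneg_left ?_ (pow_nonneg hr0 n)
      have := h (v + n) (by omega)
      rw [← add_assoc]
      linarith
  have iter' : ∀ n : ℕ, u v - K ≤ (C * (1 + v) - K) * r ^ n + C * (n * r ^ n) := by
    intro n
    refine (iter n).trans ?_
    have h1 := mul_le_mul_of_nonneg_left (hC (v + n)) (pow_nonneg hr0 n)
    push_cast at h1
    linarith
  have lim : Filter.Tendsto (fun n : ℕ => (C * (1 + v) - K) * r ^ n + C * (n * r ^ n))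
      Filter.atTop (nhds ((C * (1 + v) - K) * 0 + C * 0)) :=
    ((tendsto_pow_atTop_nhds_zero_of_lt_one hr0 hr1).const_mul _).add
      ((tendsto_self_mul_const_pow_of_lt_one hr0 hr1).const_mul _)
  have := ge_of_tendsto' lim iter'
  linarith

theorem tsum_successProb_shift_le (j : Fin N) {u : ℕ → ℝ} (hu : LinearGrowth u) {κ C : ℝ}
    (h : ∀ v : ℕ, u v ≤ κ * v + C) (v : ℕ) :
    ∑' l, S.successProb j l * u (v + l) ≤ κ * (S.L j - 1 + S.p) + (κ * v + C) * S.p := by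
  have h1 := S.hasSum_successProb_affine j κ (κ * v + C)
  rw [← h1.tsum_eq]
  refine Summable.tsum_le_tsum (fun l => ?_) (S.summable_successProb_mul j (hu.comp_add v))
    h1.summable
  refine mul_le_mul_of_nonneg_left ((h _).trans ?_) (S.successProb_nonneg j l)
  push_cast
  linarith

/-- A function of linear growth that is subharmonic up to the running cost `δ * (v - x)`, paid for
the successful outcome, is bounded above: as long as the slope `κ` of a linear bound satisfies
`p * κ > δ`, it can be lowered by `δ`; once `p * κ ≤ δ` the running cost absorbs the second
alternative up to a constant. -/
theorem bounded_of_subharmonic (j : Fin N) {u : ℕ → ℝ} {δ x : ℝ} (hδ : 0 < δ)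
    (hu : LinearGrowth u)
    (h : ∀ v : ℕ, u v ≤ (1 - S.p) * u (v + 1) +
      max 0 (∑' l, S.successProb j l * u (v + l) - δ * (v - x))) :
    ∃ K : ℝ, ∀ v, u v ≤ K := by
  have hp0 := S.p_pos
  have hp1 := S.p_le_one
  have main : ∀ n : ℕ, ∀ κ C : ℝ, 0 ≤ κ → κ ≤ δ / S.p + n * δ →
      (∀ v : ℕ, u v ≤ κ * v + C) → ∃ K : ℝ, ∀ v, u v ≤ K := by
    intro n
    induction n with
    | zero =>
      intro κ C hκ hκn hle
      have hpκ : S.p * κ ≤ δ := by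
        have : κ ≤ δ / S.p := by simpa using hκn
        rwa [le_div_iff₀ hp0, mul_comm] at this
      set K1 : ℝ := |κ * (S.L j - 1 + S.p) + C * S.p + δ * x| with hK1
      have hstep : ∀ v : ℕ, u v ≤ (1 - S.p) * u (v + 1) + (1 - (1 - S.p)) * (K1 / S.p) := by
        intro v
        have e : (1 - (1 - S.p)) * (K1 / S.p) = K1 := by field_simp; ring
        rw [e]
        refine (h v).trans (add_le_add_right (max_le (abs_nonneg _) ?_) _)
        have h1 := S.tsum_successProb_shift_le j hu hle v
        have h2 : (S.p * κ) * v ≤ δ * v := mul_le_mul_of_nonneg_right hpκ v.cast_nonneg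
        have h3 := le_abs_self (κ * (S.L j - 1 + S.p) + C * S.p + δ * x)
        linarith
      refine ⟨K1 / S.p, fun v => le_of_le_shift (V := 0) (C := κ + |C|) (by linarith)
        (by linarith) (fun v => (hle v).trans ?_) (fun v _ => hstep v) v v.zero_le⟩
      have h4 := mul_nonneg (abs_nonneg C) (Nat.cast_nonneg (α := ℝ) v)
      have h5 := le_abs_self C
      linarith
    | succ n ih =>
      intro κ C hκ hκn hle
      by_cases hpκ : S.p * κ ≤ δ
      · refine ih κ C hκ ?_ hle
        have : κ ≤ δ / S.p := by rwa [le_div_iff₀ hp0, mul_comm]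
        have : 0 ≤ n * δ := by positivity
        linarith
      · push Not at hpκ
        refine ih (κ - δ)
          ((1 - S.p) * (κ + C) + |κ * (S.L j - 1 + S.p) + C * S.p + δ * x|) ?_ ?_ fun v => ?_
        · nlinarith
        · push_cast at hκn
          linarith
        · have h1 := S.tsum_successProb_shift_le j hu hle v
          have h2 := mul_le_mul_of_nonneg_left (hle (v + 1)) (sub_nonneg.2 hp1)
          have h3 := le_abs_self (κ * (S.L j - 1 + S.p) + C * S.p + δ * x)
          have h4 := abs_nonneg (κ * (S.L j - 1 + S.p) + C * S.p + δ * x)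
          have h5 : 0 ≤ (S.p * κ - δ) * v := mul_nonneg (by linarith) v.cast_nonneg
          have h6 : max 0 (∑' l, S.successProb j l * u (v + l) - δ * (v - x)) ≤
              (S.p * κ - δ) * v + |κ * (S.L j - 1 + S.p) + C * S.p + δ * x| :=
            max_le (by linarith) (by linarith)
          push_cast at h2
          have := h v
          linarith
  obtain ⟨C, hC0, hC⟩ := hu.nonneg_bound
  obtain ⟨n, hn⟩ := exists_nat_ge (C / δ)
  refine main n C C hC0 ?_ fun v => (le_abs_self _).trans ((hC v).trans (by linarith))
  rw [div_le_iff₀ hδ] at hn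
  have : 0 ≤ δ / S.p := by positivity
  linarith

/-- Beyond the age `x`, where the running cost is nonnegative, such a function is nonpositive: it is
bounded above, so the running cost rules out the second alternative at large ages, where iteration
of the first one gives the sign; this propagates down to `x`. -/
theorem nonpos_of_subharmonic (j : Fin N) {u : ℕ → ℝ} {δ x : ℝ} (hδ : 0 < δ)
    (hu : LinearGrowth u)
    (h : ∀ v : ℕ, u v ≤ (1 - S.p) * u (v + 1) +
      max 0 (∑' l, S.successProb j l * u (v + l) - δ * (v - x))) :
    ∀ v : ℕ, x ≤ v → u v ≤ 0 := by
  have hp0 := S.p_pos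
  have hp1 := S.p_le_one
  obtain ⟨K, hK⟩ := S.bounded_of_subharmonic j hδ hu h
  obtain ⟨V, hV⟩ := exists_nat_ge (K * S.p / δ + x)
  have large : ∀ v, V ≤ v → u v ≤ 0 := by
    refine le_of_le_shift (r := 1 - S.p) (C := |K|) (by linarith) (by linarith)
      (fun v => ?_) (fun v hv => ?_)
    · have h4 := mul_nonneg (abs_nonneg K) (Nat.cast_nonneg (α := ℝ) v)
      linarith [hK v, le_abs_self K]
    · have h1 := S.tsum_successProb_shift_le j hu (κ := 0) (C := K) (by simpa using hK) v
      have hv' : K * S.p / δ ≤ v - x := by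
        have : (V : ℝ) ≤ v := by exact_mod_cast hv
        linarith
      rw [div_le_iff₀ hδ] at hv'
      have h2 := h v
      rw [max_eq_left (by linarith)] at h2
      linarith
  have down : ∀ n v : ℕ, V ≤ v + n → x ≤ v → u v ≤ 0 := by
    intro n
    induction n with
    | zero => exact fun v hv _ => large v hv
    | succ n ih =>
      intro v hv hx
      have next : ∀ l : ℕ, 1 ≤ l → u (v + l) ≤ 0 := by
        intro l hl
        refine ih (v + l) (by omega) (hx.trans ?_)
        exact_mod_cast Nat.le_add_right v l
      have h1 : ∑' l, S.successProb j l * u (v + l) ≤ 0 := by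
        refine tsum_nonpos fun l => ?_
        rcases Nat.eq_zero_or_pos l with rfl | hl
        · rw [successProb_zero, zero_mul]
        · exact mul_nonpos_of_nonneg_of_nonpos (S.successProb_nonneg j l) (next l hl)
      have h2 := h v
      have h3 : 0 ≤ δ * (v - x) := mul_nonneg hδ.le (by linarith)
      rw [max_eq_left (by linarith)] at h2
      have h4 := mul_nonpos_of_nonneg_of_nonpos (sub_nonneg.2 hp1) (next 1 le_rfl)
      linarith
  exact fun v hx => down V v (by omega) hx

/-! ### The gap between the two actions -/

/-- Slope of the relative value at ages at which the source `i` is scheduled. -/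
noncomputable def slope (i : Fin N) : ℝ := S.α i * S.L i / S.p

/-- The real age at which, for average cost `θ`, scheduling `m` once and `i` ever after is as good
as scheduling `i` at once. -/
noncomputable def indifferenceAge (θ : ℝ) (i m : Fin N) : ℝ :=
  θ / S.α i - ((S.L m : ℝ) - 1) / (2 * S.p) - (S.L i : ℝ) / S.p

/-- Advantage of scheduling `i` over scheduling `m` at age `v`, if the relative value deviates by
`D` from the affine relative value of always scheduling `i`. -/
noncomputable def gap (θ : ℝ) (D : ℕ → ℝ) (i m : Fin N) (v : ℕ) : ℝ :=
  S.α i * S.L m * (v - S.indifferenceAge θ i m) + ∑' l, S.successProb m l * D (v + l)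

section Gap

variable {S} {i m : Fin N} {lam θ b : ℝ} {h D : ℕ → ℝ}

theorem QSelf_eq_affine
    (hb : S.p * b = (1 - S.p) * S.slope i + S.α i * S.w i + (lam - θ) * S.L i +
      ∑' l, S.successProb i l * h l) (v : ℕ) :
    S.QSelf lam θ h i v =
      S.slope i * v + b - (1 - S.p) * (S.slope i * (v + 1) + b) := by
  have hs : S.p * S.slope i = S.α i * S.L i := by
    rw [slope]; field_simp [S.p_pos.ne']
  have hB : ∑' l, S.successProb i l * h l = ∑' l, S.p * S.deliveryProb i l * h l := rfl
  rw [QSelf, g, ← hB]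
  linear_combination (-(v : ℝ)) * hs - hb

theorem QOther_eq_QSelf_add_gap (hD : LinearGrowth D)
    (hh : ∀ v : ℕ, h v = S.slope i * v + b + D v)
    (hb : S.p * b = (1 - S.p) * S.slope i + S.α i * S.w i + (lam - θ) * S.L i +
      ∑' l, S.successProb i l * h l) (v : ℕ) :
    S.QOther θ h i m v = S.QSelf lam θ h i v + S.gap θ D i m v := by
  have hp := S.p_pos.ne'
  have hα := (S.α_pos i).ne'
  have hsum : ∑' l, S.successProb m l * h (v + l) =
      S.slope i * (S.L m - 1 + S.p) + (S.slope i * v + b) * S.p +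
        ∑' l, S.successProb m l * D (v + l) := by
    have h1 := S.hasSum_successProb_affine m (S.slope i) (S.slope i * v + b)
    rw [← h1.tsum_eq, ← h1.summable.tsum_add (S.summable_successProb_mul m (hD.comp_add v))]
    refine tsum_congr fun l => ?_
    rw [hh]; push_cast; ring
  have hB : ∑' l, S.p * S.deliveryProb m l * h (v + l) =
    ∑' l, S.successProb m l * h (v + l) := rfl
  rw [QSelf_eq_affine hb, QOther, g, gap, hB, hsum, slope, indifferenceAge, w]
  field_simp
  ring

/-- The Bellman equation, in terms of the deviation `D` from the affine function. -/
theorem bellman_iff (hD : LinearGrowth D)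
    (hh : ∀ v : ℕ, h v = S.slope i * v + b + D v)
    (hb : S.p * b = (1 - S.p) * S.slope i + S.α i * S.w i + (lam - θ) * S.L i +
      ∑' l, S.successProb i l * h l) (v : ℕ) :
    h v = (1 - S.p) * h (v + 1) + min (S.QSelf lam θ h i v) (S.QOther θ h i m v) ↔
      D v = (1 - S.p) * D (v + 1) + min 0 (S.gap θ D i m v) := by
  have e : min (S.QSelf lam θ h i v) (S.QOther θ h i m v) =
      S.QSelf lam θ h i v + min 0 (S.gap θ D i m v) := by
    rw [QOther_eq_QSelf_add_gap hD hh hb, ← min_add_add_left, add_zero]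
  rw [e, QSelf_eq_affine hb, hh, hh (v + 1)]
  push_cast
  constructor <;> intro h' <;> linarith

/-- The deviation is nonpositive, so `m` is strictly better below the indifference age; minus the
deviation is subharmonic up to the running cost, so it vanishes beyond the indifference age, and
`i` is optimal there. -/
theorem IsRelativeValue.threshold (hh : S.IsRelativeValue lam θ i m h) (v : ℕ) :
    ((v : ℝ) < S.indifferenceAge θ i m → S.QOther θ h i m v < S.QSelf lam θ h i v) ∧
      (S.indifferenceAge θ i m ≤ v → S.QSelf lam θ h i v ≤ S.QOther θ h i m v) := by
  obtain ⟨hbell, hlin⟩ := hh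
  have hp0 := S.p_pos
  have hp1 := S.p_le_one
  have hδ : 0 < S.α i * S.L m :=
    mul_pos (S.α_pos i) (by exact_mod_cast S.one_le_L m)
  obtain ⟨b, hb⟩ : ∃ b, S.p * b = (1 - S.p) * S.slope i + S.α i * S.w i + (lam - θ) * S.L i +
      ∑' l, S.successProb i l * h l := ⟨_, mul_div_cancel₀ _ hp0.ne'⟩
  obtain ⟨D, hDdef⟩ : ∃ D : ℕ → ℝ, ∀ v, D v = h v + (-S.slope i * v + -b) :=
    ⟨fun v => h v + (-S.slope i * v + -b), fun _ => rfl⟩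
  have hD : LinearGrowth D := by
    rw [funext hDdef]
    exact LinearGrowth.add hlin (linearGrowth_affine _ _)
  have hh' : ∀ v : ℕ, h v = S.slope i * v + b + D v := fun v => by rw [hDdef]; ring
  have hrec := fun v => (bellman_iff hD hh' hb v).1 (hbell v)
  have hDle : ∀ v, D v ≤ 0 := by
    obtain ⟨C, hC⟩ := hD
    refine fun v => le_of_le_shift (r := 1 - S.p) (V := 0) (C := C) (by linarith) (by linarith)
      (fun v => (le_abs_self _).trans (hC v)) (fun v _ => ?_) v v.zero_le
    have := min_le_left 0 (S.gap θ D i m v)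
    linarith [hrec v]
  have hneg : ∀ v, ∑' l, S.successProb m l * (-1 * D (v + l)) =
      -∑' l, S.successProb m l * D (v + l) := by
    intro v
    rw [← tsum_neg]
    exact tsum_congr fun l => by ring
  have hDge := S.nonpos_of_subharmonic m (u := fun v => -1 * D v)
    (x := S.indifferenceAge θ i m) hδ (hD.const_mul (-1)) (fun v => by
      have e : max 0 (∑' l, S.successProb m l * (-1 * D (v + l)) -
          S.α i * S.L m * (v - S.indifferenceAge θ i m)) = -min 0 (S.gap θ D i m v) := by
        rw [← max_neg_neg, neg_zero, hneg, gap]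
        congr 1; ring
      rw [e, hrec v]
      linarith)
  rw [QOther_eq_QSelf_add_gap hD hh' hb]
  constructor
  · intro hv
    have h1 : ∑' l, S.successProb m l * D (v + l) ≤ 0 :=
      tsum_nonpos fun l => mul_nonpos_of_nonneg_of_nonpos (S.successProb_nonneg m l) (hDle _)
    have h2 := mul_neg_of_pos_of_neg hδ (sub_neg.2 hv)
    have : S.gap θ D i m v < 0 := by rw [gap]; linarith
    linarith
  · intro hv
    have h1 : ∑' l, S.successProb m l * D (v + l) = 0 := by
      have hz : ∀ l, D (v + l) = 0 := by
        intro l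
        refine le_antisymm (hDle _) ?_
        have := hDge (v + l) (hv.trans (by exact_mod_cast Nat.le_add_right v l))
        linarith
      simp [hz]
    have h2 := mul_nonneg hδ.le (sub_nonneg.2 hv)
    rw [gap, h1]
    linarith

end Gap

/-! ### Existence of a solution of the Bellman equation -/

/-- One step of the backward recursion for the deviation, cut off at the age `V`. Every term on
the right with nonzero weight refers to an age larger than `v`, so `V` steps from `0` reach a fixed
point. -/
noncomputable def deviationStep (V : ℕ) (i m : Fin N) (θ : ℝ) (D : ℕ → ℝ) (v : ℕ) : ℝ :=
  if V ≤ v then 0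
  else (1 - S.p) * D (v + 1) + min 0 (S.α i * S.L m * (v - S.indifferenceAge θ i m) +
    ∑ l ∈ Finset.range V, S.successProb m l * D (v + l))

/-- The `n`-th iterate of the backward recursion. -/
noncomputable def deviation (V : ℕ) (i m : Fin N) (θ : ℝ) : ℕ → ℕ → ℝ
  | 0 => fun _ => 0
  | n + 1 => S.deviationStep V i m θ (deviation V i m θ n)

section Existence

variable (V : ℕ) (i m : Fin N) (θ : ℝ)

theorem deviation_of_le (n : ℕ) {v : ℕ} (hv : V ≤ v) : S.deviation V i m θ n v = 0 := by
  cases n with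
  | zero => rfl
  | succ n => simp [deviation, deviationStep, hv]

theorem deviation_nonpos (n v : ℕ) : S.deviation V i m θ n v ≤ 0 := by
  induction n generalizing v with
  | zero => exact le_rfl
  | succ n ih =>
    rw [deviation, deviationStep]
    split_ifs
    · exact le_rfl
    · have := mul_nonpos_of_nonneg_of_nonpos (sub_nonneg.2 S.p_le_one) (ih (v + 1))
      exact add_nonpos this (min_le_left _ _)

theorem deviation_succ_eq (n : ℕ) {v : ℕ} (hv : V ≤ v + n) :
    S.deviation V i m θ (n + 1) v = S.deviation V i m θ n v := by
  induction n generalizing v with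
  | zero => rw [S.deviation_of_le V i m θ _ (v := v) hv, S.deviation_of_le V i m θ _ (v := v) hv]
  | succ n ih =>
    have h1 : ∀ l, 1 ≤ l →
        S.deviation V i m θ (n + 1) (v + l) = S.deviation V i m θ n (v + l) :=
      fun l hl => ih (by omega)
    rw [deviation, deviationStep, h1 1 le_rfl]
    conv_rhs => rw [deviation, deviationStep]
    congr 4
    refine Finset.sum_congr rfl fun l _ => ?_
    rcases Nat.eq_zero_or_pos l with rfl | hl
    · rw [successProb_zero, zero_mul, zero_mul]
    · rw [h1 l hl]

theorem continuous_deviation (n v : ℕ) : Continuous fun θ => S.deviation V i m θ n v := by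
  induction n generalizing v with
  | zero => exact continuous_const
  | succ n ih =>
    simp only [deviation, deviationStep]
    split_ifs
    · exact continuous_const
    · have hx : Continuous fun θ => S.indifferenceAge θ i m := by
        unfold indifferenceAge
        fun_prop
      have hsum : Continuous fun θ =>
          ∑ l ∈ Finset.range V, S.successProb m l * S.deviation V i m θ n (v + l) :=
        continuous_finsetSum _ fun l _ => continuous_const.mul (ih _)
      exact (continuous_const.mul (ih _)).add
        (continuous_const.min ((continuous_const.mul (continuous_const.sub hx)).add hsum))

theorem deviation_eq_zero (hx : S.indifferenceAge θ i m ≤ 0) (n v : ℕ) :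
    S.deviation V i m θ n v = 0 := by
  induction n generalizing v with
  | zero => rfl
  | succ n ih =>
    rw [deviation, deviationStep]
    have h1 : 0 ≤ S.α i * S.L m * (v - S.indifferenceAge θ i m) := by
      have := (S.α_pos i).le
      have hv : (0 : ℝ) ≤ v := v.cast_nonneg
      have : 0 ≤ (v : ℝ) - S.indifferenceAge θ i m := by linarith
      positivity
    simp [ih, h1]

theorem tsum_successProb_mul_of_le {j : Fin N} {D : ℕ → ℝ} {V : ℕ} (hD : ∀ v, V ≤ v → D v = 0)
    (v : ℕ) : ∑' l, S.successProb j l * D (v + l) =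
      ∑ l ∈ Finset.range V, S.successProb j l * D (v + l) := by
  refine tsum_eq_sum fun l hl => ?_
  rw [hD (v + l) (by simp at hl; omega), mul_zero]

theorem deviation_bellman (hV : S.indifferenceAge θ i m ≤ V) (v : ℕ) :
    S.deviation V i m θ V v = (1 - S.p) * S.deviation V i m θ V (v + 1) +
      min 0 (S.gap θ (S.deviation V i m θ V) i m v) := by
  have hz := fun v (hv : V ≤ v) => S.deviation_of_le V i m θ V hv
  rw [gap, S.tsum_successProb_mul_of_le hz]
  by_cases hv : V ≤ v
  · have hsum : ∑ l ∈ Finset.range V, S.successProb m l * S.deviation V i m θ V (v + l) = 0 :=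
      Finset.sum_eq_zero fun l _ => by rw [hz (v + l) (by omega), mul_zero]
    have h1 : 0 ≤ S.α i * S.L m * (v - S.indifferenceAge θ i m) := by
      have := (S.α_pos i).le
      have hv : (V : ℝ) ≤ v := by exact_mod_cast hv
      have : 0 ≤ (v : ℝ) - S.indifferenceAge θ i m := by linarith
      positivity
    rw [hz v hv, hz (v + 1) (by omega), hsum, add_zero, min_eq_left h1]
    ring
  · rw [← S.deviation_succ_eq V i m θ V (v := v) (by omega), deviation, deviationStep, if_neg hv]

theorem linearGrowth_deviation : LinearGrowth (S.deviation V i m θ V) := by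
  refine ⟨∑ w ∈ Finset.range V, |S.deviation V i m θ V w|, fun v => ?_⟩
  have h0 : 0 ≤ ∑ w ∈ Finset.range V, |S.deviation V i m θ V w| :=
    Finset.sum_nonneg fun _ _ => abs_nonneg _
  have hv : (0 : ℝ) ≤ v := v.cast_nonneg
  have : |S.deviation V i m θ V v| ≤ ∑ w ∈ Finset.range V, |S.deviation V i m θ V w| := by
    by_cases hv : V ≤ v
    · rw [S.deviation_of_le V i m θ V hv, abs_zero]; exact h0
    · exact Finset.single_le_sum (f := fun w => |S.deviation V i m θ V w|)
        (fun _ _ => abs_nonneg _) (by simpa using hv)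
  nlinarith [mul_nonneg h0 hv]

/-- For every `θ` with indifference age at most `V`, the backward recursion solves the Bellman
equation up to the consistency of the expected relative value after an update of `i`. That
consistency is one scalar equation in `θ`, solved by the intermediate value theorem. -/
theorem exists_isRelativeValue (lam : ℝ) :
    ∃ (θ : ℝ) (h : ℕ → ℝ), S.IsRelativeValue lam θ i m h := by
  have hp := S.p_pos
  have hα := S.α_pos i
  have hLi : (0 : ℝ) < S.L i := by exact_mod_cast S.one_le_L i
  set c : ℝ := S.slope i * S.L i + S.α i * S.w i with hc
  -- above `Θ` the consistency defect is negative, whatever the deviation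
  set Θ : ℝ := lam + c / S.L i with hΘ
  have hΘ' : c + (lam - Θ) * S.L i = 0 := by
    rw [hΘ]; field_simp; ring
  obtain ⟨V, hV⟩ := exists_nat_ge (S.indifferenceAge Θ i m)
  set F : ℝ → ℝ := fun θ => c + (lam - θ) * S.L i +
    ∑ l ∈ Finset.range V, S.successProb i l * S.deviation V i m θ V l with hF
  have hFc : Continuous F := by
    have : Continuous fun θ =>
        ∑ l ∈ Finset.range V, S.successProb i l * S.deviation V i m θ V l :=
      continuous_finsetSum _ fun l _ => continuous_const.mul (S.continuous_deviation V i m V l)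
    exact (continuous_const.add ((continuous_const.sub continuous_id).mul
      continuous_const)).add this
  -- below `θ₀` the indifference age is nonpositive and the deviation vanishes
  set θ₀ : ℝ := min Θ (S.α i * (((S.L m : ℝ) - 1) / (2 * S.p) + (S.L i : ℝ) / S.p)) with hθ₀
  have hx₀ : S.indifferenceAge θ₀ i m ≤ 0 := by
    have : θ₀ / S.α i ≤ ((S.L m : ℝ) - 1) / (2 * S.p) + (S.L i : ℝ) / S.p := by
      rw [div_le_iff₀ hα, mul_comm]; exact min_le_right _ _
    rw [indifferenceAge]; linarith
  have hF1 : F Θ ≤ 0 := by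
    have : ∑ l ∈ Finset.range V, S.successProb i l * S.deviation V i m Θ V l ≤ 0 :=
      Finset.sum_nonpos fun l _ => mul_nonpos_of_nonneg_of_nonpos (S.successProb_nonneg i l)
        (S.deviation_nonpos V i m Θ V l)
    simp only [hF]; linarith
  have hF0 : 0 ≤ F θ₀ := by
    have h1 : 0 ≤ (Θ - θ₀) * S.L i := mul_nonneg (sub_nonneg.2 (min_le_left _ _)) hLi.le
    simp only [hF, S.deviation_eq_zero V i m θ₀ hx₀, mul_zero, Finset.sum_const_zero]
    linarith
  obtain ⟨θ, ⟨_, hθ⟩, hFθ⟩ := intermediate_value_Icc' (min_le_left _ _ : θ₀ ≤ Θ)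
    hFc.continuousOn ⟨hF1, hF0⟩
  have hxV : S.indifferenceAge θ i m ≤ V := by
    refine le_trans ?_ hV
    rw [indifferenceAge, indifferenceAge]
    have := div_le_div_of_nonneg_right hθ hα.le
    linarith
  set D := S.deviation V i m θ V with hDdef
  have hD : LinearGrowth D := S.linearGrowth_deviation V i m θ
  obtain ⟨b, hb⟩ : ∃ b, S.p * b = (1 - S.p) * S.slope i + S.α i * S.w i + (lam - θ) * S.L i :=
    ⟨_, mul_div_cancel₀ _ hp.ne'⟩
  obtain ⟨h, hh⟩ : ∃ h : ℕ → ℝ, ∀ v : ℕ, h v = S.slope i * v + b + D v := ⟨_, fun _ => rfl⟩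
  have hsum : ∑' l, S.successProb i l * h l = 0 := by
    have h1 := S.hasSum_successProb_affine i (S.slope i) b
    have h2 := S.tsum_successProb_mul_of_le (j := i)
      (fun v (hv : V ≤ v) => S.deviation_of_le V i m θ V hv) 0
    simp only [zero_add] at h2
    have h3 : ∑' l, S.successProb i l * h l = S.slope i * (S.L i - 1 + S.p) + b * S.p +
        ∑' l, S.successProb i l * D l := by
      rw [← h1.tsum_eq, ← h1.summable.tsum_add (S.summable_successProb_mul i hD)]
      exact tsum_congr fun l => by rw [hh]; ring
    rw [h3, hDdef, h2]
    simp only [hF] at hFθ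
    linear_combination hFθ + hb
  refine ⟨θ, h, fun v => ?_, ?_⟩
  · exact (bellman_iff hD hh (by rw [hsum, add_zero, hb]) v).2 (S.deviation_bellman V i m θ hxV v)
  · change LinearGrowth h
    rw [funext hh]
    exact (linearGrowth_affine _ _).add hD

end Existence

/-! ### Transitions of the age -/

/-- Expectation of `f` at the age of source `i` after a stage in which `j` is scheduled at
age `v`. -/
noncomputable def transition (i j : Fin N) (f : ℕ → ℝ) (v : ℕ) : ℝ :=
  (1 - S.p) * f (v + 1) + ∑' l, S.successProb j l * f (if j = i then l else v + l)

theorem LinearGrowth.comp_nextAge {f : ℕ → ℝ} (hf : LinearGrowth f) (i j : Fin N) (v : ℕ) :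
    LinearGrowth fun l => f (if j = i then l else v + l) := by
  split_ifs
  · exact hf
  · exact hf.comp_add v

theorem hasSum_stage_nextAge (i j : Fin N) {f : ℕ → ℝ} (hf : LinearGrowth f) (v : ℕ) :
    HasSum (fun o => (S.stage j o).toReal * f (nextAge i j v o)) (S.transition i j f v) := by
  have h := (S.summable_successProb_mul j (hf.comp_nextAge i j v)).hasSum
  have h' := S.hasSum_stage (j := j) (f := fun o => f (nextAge i j v o))
    (h.of_eq (fun l => by simp [nextAge]) rfl)
  simpa [nextAge, transition] using h'

theorem expect_stage_nextAge (i j : Fin N) {f : ℕ → ℝ} (hf : LinearGrowth f) (v : ℕ) :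
    Expectable ((S.stage j).map (nextAge i j v)) f ∧
      expect ((S.stage j).map (nextAge i j v)) f = S.transition i j f v := by
  have h := S.hasSum_stage_nextAge i j hf v
  obtain ⟨h1, h2⟩ := expect_map (μ := S.stage j) (g := nextAge i j v) (f := f) h.summable
  exact ⟨h1, h2.trans h.tsum_eq⟩

theorem transition_self (i : Fin N) (f : ℕ → ℝ) (v : ℕ) :
    S.transition i i f v = (1 - S.p) * f (v + 1) + ∑' l, S.successProb i l * f l := by
  simp [transition]

theorem transition_other {i j : Fin N} (hj : j ≠ i) (f : ℕ → ℝ) (v : ℕ) :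
    S.transition i j f v = (1 - S.p) * f (v + 1) + ∑' l, S.successProb j l * f (v + l) := by
  simp [transition, hj]

theorem transition_self_cast (i : Fin N) (v : ℕ) :
    S.transition i i (fun v => (v : ℝ)) v = (1 - S.p) * v + S.L i := by
  rw [transition_self, (S.hasSum_successProb_mul i).tsum_eq]
  push_cast; ring

theorem transition_other_cast {i j : Fin N} (hj : j ≠ i) (v : ℕ) :
    S.transition i j (fun v => (v : ℝ)) v = v + S.L j := by
  rw [S.transition_other hj]
  have h := (S.hasSum_successProb_affine j 1 v).tsum_eq
  have e : ∑' l : ℕ, S.successProb j l * ((v + l : ℕ) : ℝ) =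
      ∑' l : ℕ, S.successProb j l * (1 * (l : ℝ) + v) :=
    tsum_congr fun l => by push_cast; ring
  rw [e, h]
  push_cast; ring

theorem linearGrowth_transition (i j : Fin N) {f : ℕ → ℝ} (hf : LinearGrowth f) :
    LinearGrowth (S.transition i j f) := by
  obtain ⟨C, hC0, hC⟩ := hf.nonneg_bound
  have hp0 := S.p_pos
  have hp1 := S.p_le_one
  have hL : (1 : ℝ) ≤ S.L j := by exact_mod_cast S.one_le_L j
  refine ⟨C * (1 + S.L j), fun v => ?_⟩
  have hv : (0 : ℝ) ≤ v := v.cast_nonneg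
  have hs := S.hasSum_successProb_affine j C (C * (1 + v))
  have h1 : |∑' l, S.successProb j l * f (if j = i then l else v + l)| ≤
      C * (S.L j - 1 + S.p) + C * (1 + v) * S.p := by
    rw [← hs.tsum_eq, ← Real.norm_eq_abs]
    refine tsum_of_norm_bounded hs.summable.hasSum fun l => ?_
    rw [norm_mul, Real.norm_eq_abs, Real.norm_eq_abs, abs_of_nonneg (S.successProb_nonneg j l)]
    refine mul_le_mul_of_nonneg_left ((hC _).trans ?_) (S.successProb_nonneg j l)
    have h2 : (((if j = i then l else v + l : ℕ)) : ℝ) ≤ v + l := by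
      split_ifs
      · linarith
      · push_cast; exact le_rfl
    nlinarith
  have h3 : |(1 - S.p) * f (v + 1)| ≤ (1 - S.p) * (C * (2 + v)) := by
    rw [abs_mul, abs_of_nonneg (sub_nonneg.2 hp1)]
    refine mul_le_mul_of_nonneg_left ((hC _).trans ?_) (sub_nonneg.2 hp1)
    push_cast; nlinarith
  refine (abs_add_le _ _).trans ((add_le_add h3 h1).trans ?_)
  have h4 : 0 ≤ C * (S.L j * v) := by positivity
  nlinarith

/-- A quantity that depends on the age and on the action chosen by a two-action policy grows at
most linearly if it does so for each of the two actions. -/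
theorem linearGrowth_of_policy {i m : Fin N} {π : ℕ → Fin N} (hπ : π ∈ twoActionPolicies i m)
    {F : Fin N → ℕ → ℝ} (hi : LinearGrowth (F i)) (hm : LinearGrowth (F m)) :
    LinearGrowth fun v => F (π v) v := by
  obtain ⟨C, hC0, hC⟩ := hi.nonneg_bound
  obtain ⟨C', hC0', hC'⟩ := hm.nonneg_bound
  refine ⟨C + C', fun v => ?_⟩
  have hv : (0 : ℝ) ≤ 1 + v := by positivity
  have h1 := mul_nonneg hC0 hv
  have h2 := mul_nonneg hC0' hv
  rcases hπ v with h | h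
  · simp only [h]; linarith [hC v]
  · simp only [h]; linarith [hC' v]

theorem linearGrowth_stageCost (lam : ℝ) (i j : Fin N) :
    LinearGrowth (S.stageCost lam i j) := by
  have h := linearGrowth_affine (S.α i * S.L j)
    (S.α i * S.w j + if j = i then lam * S.meanDuration i else 0)
  convert h using 2 with v
  rw [stageCost, ageCost_eq, g]; ring

/-! ### The Bellman equation along the trajectory of a policy -/

section Chain

variable {S} {i m : Fin N} {π : ℕ → Fin N}

theorem expect_ageLaw_succ_aux (hπ : π ∈ twoActionPolicies i m) (v₀ k : ℕ)
    (hk : ∀ f, LinearGrowth f → Expectable (S.ageLaw i π v₀ k) f) {f : ℕ → ℝ}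
    (hf : LinearGrowth f) :
    Expectable (S.ageLaw i π v₀ (k + 1)) f ∧
      expect (S.ageLaw i π v₀ (k + 1)) f =
        expect (S.ageLaw i π v₀ k) fun v => S.transition i (π v) f v := by
  have h := expect_bind (μ := S.ageLaw i π v₀ k)
    (κ := fun v => (S.stage (π v)).map (nextAge i (π v) v)) (f := f)
    (fun v => (S.expect_stage_nextAge i (π v) hf v).1) (by
      simp only [fun v => (S.expect_stage_nextAge i (π v) hf.abs v).2]
      exact hk _ (linearGrowth_of_policy hπ (F := fun j v => S.transition i j (fun v => |f v|) v)
        (S.linearGrowth_transition i i hf.abs) (S.linearGrowth_transition i m hf.abs)))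
  simp only [fun v => (S.expect_stage_nextAge i (π v) hf v).2] at h
  exact h

theorem expectable_ageLaw (hπ : π ∈ twoActionPolicies i m) (v₀ k : ℕ) {f : ℕ → ℝ}
    (hf : LinearGrowth f) : Expectable (S.ageLaw i π v₀ k) f := by
  induction k generalizing f with
  | zero => exact expectable_pure _ _
  | succ k ih => exact (expect_ageLaw_succ_aux hπ v₀ k (fun f hf => ih hf) hf).1

theorem expect_ageLaw_succ (hπ : π ∈ twoActionPolicies i m) (v₀ k : ℕ) {f : ℕ → ℝ}
    (hf : LinearGrowth f) :
    expect (S.ageLaw i π v₀ (k + 1)) f =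
      expect (S.ageLaw i π v₀ k) fun v => S.transition i (π v) f v :=
  (expect_ageLaw_succ_aux hπ v₀ k (fun _ hf => expectable_ageLaw hπ v₀ k hf) hf).2

theorem linearGrowth_transition_policy (hπ : π ∈ twoActionPolicies i m) {f : ℕ → ℝ}
    (hf : LinearGrowth f) : LinearGrowth fun v => S.transition i (π v) f v :=
  linearGrowth_of_policy hπ (F := fun j v => S.transition i j f v)
    (S.linearGrowth_transition i i hf) (S.linearGrowth_transition i m hf)

theorem linearGrowth_stageCost_policy (hπ : π ∈ twoActionPolicies i m) (lam : ℝ) :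
    LinearGrowth fun v => S.stageCost lam i (π v) v :=
  linearGrowth_of_policy hπ (F := fun j v => S.stageCost lam i j v)
    (S.linearGrowth_stageCost lam i i) (S.linearGrowth_stageCost lam i m)

theorem linearGrowth_meanDuration_policy (hπ : π ∈ twoActionPolicies i m) :
    LinearGrowth fun v => S.meanDuration (π v) :=
  linearGrowth_of_policy hπ (F := fun j _ => S.meanDuration j)
    (linearGrowth_const _) (linearGrowth_const _)

/-- Once the age of source `i` has reached `L i` it never falls below again, and every stage that
delivers no update of `i` lets the age grow. -/
theorem le_of_ageLaw_ne_zero (v₀ k : ℕ) {v : ℕ} (hv : S.ageLaw i π v₀ k v ≠ 0) :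
    min k (S.L i) ≤ v := by
  induction k generalizing v with
  | zero => simp
  | succ k ih =>
    have hv' : v ∈ (S.ageLaw i π v₀ (k + 1)).support := hv
    rw [ageLaw, PMF.mem_support_bind_iff] at hv'
    obtain ⟨u, hu, hv'⟩ := hv'
    rw [PMF.mem_support_map_iff] at hv'
    obtain ⟨⟨s, l⟩, ho, rfl⟩ := hv'
    have hu' := ih hu
    have ho' : (S.stage (π u) (s, l)).toReal ≠ 0 :=
      ENNReal.toReal_ne_zero.2 ⟨ho, PMF.apply_ne_top _ _⟩
    cases s with
    | false =>
      rw [toReal_stage_false] at ho'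
      have hl : l = 1 := by
        by_contra hc
        exact ho' (if_neg hc)
      simp [nextAge, hl]
      omega
    | true =>
      rw [toReal_stage_true] at ho'
      have hl : S.L (π u) ≤ l := by
        by_contra hc
        exact ho' (S.successProb_eq_zero (by omega))
      have h1 := S.one_le_L (π u)
      by_cases hi : π u = i
      · rw [hi] at hl
        simp [nextAge, hi]
        omega
      · simp [nextAge, hi]
        omega

variable {lam θ : ℝ} {h : ℕ → ℝ}

theorem bellman_self (v : ℕ) :
    S.stageCost lam i i v - θ * S.meanDuration i + S.transition i i h v =
      (1 - S.p) * h (v + 1) + S.QSelf lam θ h i v := by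
  rw [stageCost, ageCost_eq, meanDuration_eq, transition_self, QSelf, if_pos rfl]
  simp only [successProb]
  ring

theorem bellman_other (hm : m ≠ i) (v : ℕ) :
    S.stageCost lam i m v - θ * S.meanDuration m + S.transition i m h v =
      (1 - S.p) * h (v + 1) + S.QOther θ h i m v := by
  rw [stageCost, ageCost_eq, S.meanDuration_eq m, S.transition_other hm, QOther, if_neg hm]
  simp only [successProb]
  ring

/-- Expected relative cost of the `k`-th stage plus the expected relative value after it, written
as one expectation over the age at the `k`-th decision. -/
theorem expect_bellman (hπ : π ∈ twoActionPolicies i m) (hh : LinearGrowth h) (v₀ k : ℕ) :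
    Expectable (S.ageLaw i π v₀ k) (fun v => S.stageCost lam i (π v) v +
      (-θ * S.meanDuration (π v) + S.transition i (π v) h v)) ∧
    expect (S.ageLaw i π v₀ k) (fun v => S.stageCost lam i (π v) v +
      (-θ * S.meanDuration (π v) + S.transition i (π v) h v)) =
    expect (S.ageLaw i π v₀ k) (fun v => S.stageCost lam i (π v) v) -
      θ * expect (S.ageLaw i π v₀ k) (fun v => S.meanDuration (π v)) +
      expect (S.ageLaw i π v₀ (k + 1)) h := by
  have e1 := expectable_ageLaw (S := S) hπ v₀ k (S.linearGrowth_stageCost_policy hπ lam)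
  have e2 := expectable_ageLaw (S := S) hπ v₀ k
    ((S.linearGrowth_meanDuration_policy hπ).const_mul (-θ))
  have e3 := expectable_ageLaw (S := S) hπ v₀ k (S.linearGrowth_transition_policy hπ hh)
  refine ⟨e1.add (e2.add e3), ?_⟩
  rw [expect_add e1 (e2.add e3), expect_add e2 e3, expect_const_mul, expect_ageLaw_succ hπ v₀ k hh]
  ring

theorem IsRelativeValue.expect_le (hm : m ≠ i) (hπ : π ∈ twoActionPolicies i m)
    (hh : S.IsRelativeValue lam θ i m h) (v₀ k : ℕ) :
    expect (S.ageLaw i π v₀ k) h ≤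
      expect (S.ageLaw i π v₀ k) (fun v => S.stageCost lam i (π v) v) -
      θ * expect (S.ageLaw i π v₀ k) (fun v => S.meanDuration (π v)) +
      expect (S.ageLaw i π v₀ (k + 1)) h := by
  obtain ⟨e1, e2⟩ := S.expect_bellman (lam := lam) (θ := θ) hπ hh.2 v₀ k
  rw [← e2]
  refine expect_mono (expectable_ageLaw hπ v₀ k hh.2) e1 fun v _ => ?_
  rw [hh.1 v]
  rcases hπ v with hv | hv
  · rw [hv]
    linarith [bellman_self (S := S) (lam := lam) (θ := θ) (i := i) (h := h) v,
      min_le_left (S.QSelf lam θ h i v) (S.QOther θ h i m v)]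
  · rw [hv]
    linarith [bellman_other (S := S) (lam := lam) (θ := θ) (h := h) hm v,
      min_le_right (S.QSelf lam θ h i v) (S.QOther θ h i m v)]

/-- A policy that minimizes in the Bellman equation at the ages from `L i` on loses nothing from
the `L i`-th stage on, because lower ages are transient. -/
theorem IsRelativeValue.expect_eq (hm : m ≠ i) (hπ : π ∈ twoActionPolicies i m)
    (hh : S.IsRelativeValue lam θ i m h)
    (hopt : ∀ v, S.L i ≤ v → (π v = i ∧ S.QSelf lam θ h i v ≤ S.QOther θ h i m v) ∨
      (π v = m ∧ S.QOther θ h i m v ≤ S.QSelf lam θ h i v))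
    (v₀ : ℕ) {k : ℕ} (hk : S.L i ≤ k) :
    expect (S.ageLaw i π v₀ k) h =
      expect (S.ageLaw i π v₀ k) (fun v => S.stageCost lam i (π v) v) -
      θ * expect (S.ageLaw i π v₀ k) (fun v => S.meanDuration (π v)) +
      expect (S.ageLaw i π v₀ (k + 1)) h := by
  rw [← (S.expect_bellman (lam := lam) (θ := θ) hπ hh.2 v₀ k).2]
  refine expect_congr fun v hv => ?_
  have hLv : S.L i ≤ v := by
    have := le_of_ageLaw_ne_zero v₀ k hv
    omega
  rw [hh.1 v]
  rcases hopt v hLv with ⟨hv, hq⟩ | ⟨hv, hq⟩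
  · rw [hv, min_eq_left hq]
    linarith [bellman_self (S := S) (lam := lam) (θ := θ) (i := i) (h := h) v]
  · rw [hv, min_eq_right hq]
    linarith [bellman_other (S := S) (lam := lam) (θ := θ) (h := h) hm v]

theorem one_le_expect_meanDuration (hπ : π ∈ twoActionPolicies i m) (v₀ k : ℕ) :
    1 ≤ expect (S.ageLaw i π v₀ k) fun v => S.meanDuration (π v) := by
  rw [← expect_const (S.ageLaw i π v₀ k) 1]
  refine expect_mono (expectable_const _ _)
    (expectable_ageLaw hπ v₀ k (S.linearGrowth_meanDuration_policy hπ)) fun v _ => ?_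
  rw [meanDuration_eq]
  exact_mod_cast S.one_le_L _

theorem expect_meanDuration_le (hπ : π ∈ twoActionPolicies i m) (v₀ k : ℕ) :
    expect (S.ageLaw i π v₀ k) (fun v => S.meanDuration (π v)) ≤ S.L i + S.L m := by
  rw [← expect_const (S.ageLaw i π v₀ k) (S.L i + S.L m)]
  refine expect_mono (expectable_ageLaw hπ v₀ k (S.linearGrowth_meanDuration_policy hπ))
    (expectable_const _ _) fun v _ => ?_
  rw [meanDuration_eq]
  have h1 : (0 : ℝ) ≤ S.L i := Nat.cast_nonneg _
  have h2 : (0 : ℝ) ≤ S.L m := Nat.cast_nonneg _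
  rcases hπ v with hv | hv <;> rw [hv] <;> linarith

/-- Expected age of source `i` at the `k`-th decision instant. -/
noncomputable def meanAge (S : UpdateSystem N) (i : Fin N) (π : ℕ → Fin N) (v₀ k : ℕ) : ℝ :=
  expect (S.ageLaw i π v₀ k) fun v => (v : ℝ)

theorem expect_affine (hπ : π ∈ twoActionPolicies i m) (v₀ k : ℕ) (a b : ℝ) :
    expect (S.ageLaw i π v₀ k) (fun v => a * v + b) = a * S.meanAge i π v₀ k + b := by
  rw [expect_add ((expectable_ageLaw hπ v₀ k linearGrowth_cast).const_mul a)
    (expectable_const _ b), expect_const, expect_const_mul, meanAge]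

theorem expect_le_affine (hπ : π ∈ twoActionPolicies i m) (v₀ k : ℕ) {f : ℕ → ℝ}
    (hf : LinearGrowth f) {a b : ℝ} (hab : ∀ v : ℕ, f v ≤ a * v + b) :
    expect (S.ageLaw i π v₀ k) f ≤ a * S.meanAge i π v₀ k + b := by
  rw [← expect_affine hπ]
  exact expect_mono (expectable_ageLaw hπ v₀ k hf)
    (expectable_ageLaw hπ v₀ k (linearGrowth_affine a b)) fun v _ => hab v

theorem affine_le_expect (hπ : π ∈ twoActionPolicies i m) (v₀ k : ℕ) {f : ℕ → ℝ}
    (hf : LinearGrowth f) {a b : ℝ} (hab : ∀ v : ℕ, a * v + b ≤ f v) :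
    a * S.meanAge i π v₀ k + b ≤ expect (S.ageLaw i π v₀ k) f := by
  rw [← expect_affine hπ]
  exact expect_mono (expectable_ageLaw hπ v₀ k (linearGrowth_affine a b))
    (expectable_ageLaw hπ v₀ k hf) fun v _ => hab v

/-- Under a policy that schedules `i` at all large ages, the mean age stays bounded: every stage
contracts it by the factor `1 - p` up to a constant. -/
theorem meanAge_bounded (hm : m ≠ i) (hπ : π ∈ twoActionPolicies i m) {V : ℕ}
    (hV : ∀ v, V ≤ v → π v = i) (v₀ : ℕ) : ∃ B : ℝ, ∀ k, S.meanAge i π v₀ k ≤ B := by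
  have hp0 := S.p_pos
  have hp1 := S.p_le_one
  set M : ℝ := V + S.L i + S.L m with hM
  have hM0 : 0 ≤ M := by positivity
  refine ⟨v₀ + M / S.p, fun k => ?_⟩
  induction k with
  | zero =>
    rw [meanAge, ageLaw, expect_pure]
    have : 0 ≤ M / S.p := by positivity
    linarith
  | succ k ih =>
    rw [meanAge, expect_ageLaw_succ hπ v₀ k linearGrowth_cast]
    refine (expect_le_affine hπ v₀ k (S.linearGrowth_transition_policy hπ linearGrowth_cast)
      (a := 1 - S.p) (b := M) fun v => ?_).trans ?_
    · have h1 : (0 : ℝ) ≤ S.L i := Nat.cast_nonneg _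
      have h2 : (0 : ℝ) ≤ S.L m := Nat.cast_nonneg _
      have h3 : (0 : ℝ) ≤ V := Nat.cast_nonneg _
      by_cases hi : π v = i
      · rw [hi, transition_self_cast]; linarith
      · rw [(hπ v).resolve_left hi, S.transition_other_cast hm]
        have h4 : (v : ℝ) ≤ V := by
          have : v ≤ V := by
            by_contra hc
            exact hi (hV v (by omega))
          exact_mod_cast this
        have h5 : S.p * v ≤ V := by nlinarith [Nat.cast_nonneg (α := ℝ) v]
        linarith
    · have h1 := mul_le_mul_of_nonneg_left ih (sub_nonneg.2 hp1)
      have h2 : S.p * (M / S.p) = M := mul_div_cancel₀ _ hp0.ne'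
      have h3 : 0 ≤ S.p * (v₀ : ℝ) := by positivity
      nlinarith

end Chain

/-! ### Verification: average costs of policies -/

section Sequences

theorem le_sum_range_of_one_le {A : ℕ → ℝ} (hA : ∀ k, 1 ≤ A k) (n : ℕ) :
    (n : ℝ) ≤ ∑ k ∈ Finset.range n, A k := by
  have := Finset.card_nsmul_le_sum (Finset.range n) A 1 fun k _ => hA k
  simpa using this

/-- The optimality argument for a single trajectory, in terms of the expected stage costs `c`, the
expected stage lengths `A`, the expected relative values `φ` and the mean ages `a`. If the cost
ratio were eventually at most `r < θ`, then `φ`, and with it the mean age, would tend to infinity;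
but then the stage costs tend to infinity, and so does the cost ratio. -/
theorem frequently_lt_sum_div_sum {c A φ a : ℕ → ℝ} {θ r B C α d : ℝ}
    (hbell : ∀ k, φ k ≤ c k - θ * A k + φ (k + 1)) (hA1 : ∀ k, 1 ≤ A k) (hAB : ∀ k, A k ≤ B)
    (hC : 0 < C) (hφ : ∀ k, φ k ≤ C * a k + C) (hα : 0 < α) (hc : ∀ k, α * a k + d ≤ c k)
    (hr : r < θ) :
    ∃ᶠ K in Filter.atTop,
      r < (∑ k ∈ Finset.range (K + 1), c k) / ∑ k ∈ Finset.range (K + 1), A k := by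
  by_contra hcon
  rw [Filter.not_frequently] at hcon
  obtain ⟨K₀, hK₀⟩ := Filter.eventually_atTop.1 hcon
  have tele : ∀ n, φ 0 - φ n ≤ ∑ k ∈ Finset.range n, c k - θ * ∑ k ∈ Finset.range n, A k := by
    intro n
    induction n with
    | zero => simp
    | succ n ih =>
      rw [Finset.sum_range_succ, Finset.sum_range_succ]
      linarith [hbell n]
  have hsum : ∀ K, K₀ ≤ K →
      ∑ k ∈ Finset.range (K + 1), c k ≤ r * ∑ k ∈ Finset.range (K + 1), A k := by
    intro K hK
    have hpos : 0 < ∑ k ∈ Finset.range (K + 1), A k :=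
      lt_of_lt_of_le (by positivity) (le_sum_range_of_one_le hA1 (K + 1))
    exact (div_le_iff₀ hpos).1 (not_lt.1 (hK₀ K hK))
  obtain ⟨n₁, hn₁⟩ := exists_nat_ge ((C * ((1 + |r| * B - d) / α) + C - φ 0) / (θ - r))
  have hB : 1 ≤ B := (hA1 0).trans (hAB 0)
  have big : ∀ k, K₀ + 1 ≤ k → n₁ ≤ k → 1 ≤ c k - r * A k := by
    intro k hk hk'
    obtain ⟨K, rfl⟩ : ∃ K, k = K + 1 := ⟨k - 1, by omega⟩
    have h1 := tele (K + 1)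
    have h2 := hsum K (by omega)
    have h3 := le_sum_range_of_one_le hA1 (K + 1)
    have h4 := mul_le_mul_of_nonneg_left h3 (sub_pos.2 hr).le
    have h5 : ((n₁ : ℕ) : ℝ) ≤ ((K + 1 : ℕ) : ℝ) := by exact_mod_cast hk'
    have h6 := hn₁.trans h5
    rw [div_le_iff₀ (sub_pos.2 hr)] at h6
    have h7 : C * ((1 + |r| * B - d) / α) ≤ C * a (K + 1) := by linarith [hφ (K + 1)]
    have h8 := le_of_mul_le_mul_left h7 hC
    rw [div_le_iff₀ hα] at h8
    have h9 : r * A (K + 1) ≤ |r| * B :=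
      mul_le_mul (le_abs_self r) (hAB _) (by linarith [hA1 (K + 1)]) (abs_nonneg r)
    linarith [hc (K + 1)]
  set K₁ := max (K₀ + 1) n₁ with hK₁
  have grow : ∀ n : ℕ, ∑ k ∈ Finset.range K₁, (c k - r * A k) + n ≤
      ∑ k ∈ Finset.range (K₁ + n), (c k - r * A k) := by
    intro n
    induction n with
    | zero => simp
    | succ n ih =>
      rw [← add_assoc, Finset.sum_range_succ]
      have := big (K₁ + n) (by omega) (by omega)
      push_cast
      linarith
  obtain ⟨n, hn⟩ := exists_nat_gt (-∑ k ∈ Finset.range K₁, (c k - r * A k))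
  have h1 := grow n
  have h2 := hsum (K₁ + n - 1) (by omega)
  rw [Nat.sub_add_cancel (by omega)] at h2
  rw [Finset.sum_sub_distrib, ← Finset.mul_sum] at h1
  rw [Finset.sum_sub_distrib, ← Finset.mul_sum] at hn h1
  linarith

/-- If the Bellman equation is exact from some stage on and the expected relative values stay
bounded, then the cost ratio converges to `θ`. -/
theorem tendsto_sum_div_sum {c A φ : ℕ → ℝ} {θ B : ℝ} {k₀ : ℕ}
    (hbell : ∀ k, k₀ ≤ k → φ k = c k - θ * A k + φ (k + 1)) (hA1 : ∀ k, 1 ≤ A k)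
    (hB : ∀ k, |φ k| ≤ B) :
    Filter.Tendsto
      (fun K => (∑ k ∈ Finset.range (K + 1), c k) / ∑ k ∈ Finset.range (K + 1), A k)
      Filter.atTop (nhds θ) := by
  set s : ℕ → ℝ := fun n =>
    ∑ k ∈ Finset.range n, c k - θ * ∑ k ∈ Finset.range n, A k + φ n with hs
  have hconst : ∀ n, s (k₀ + n) = s k₀ := by
    intro n
    induction n with
    | zero => rfl
    | succ n ih =>
      rw [← ih]
      simp only [hs, ← add_assoc, Finset.sum_range_succ]
      linarith [hbell (k₀ + n) (by omega)]
  have hlim : Filter.Tendsto (fun K : ℕ => (|s k₀| + B) * (1 / ((K : ℝ) + 1)))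
      Filter.atTop (nhds ((|s k₀| + B) * 0)) :=
    tendsto_one_div_add_atTop_nhds_zero_nat.const_mul _
  rw [mul_zero] at hlim
  rw [tendsto_iff_norm_sub_tendsto_zero]
  refine squeeze_zero' (Filter.Eventually.of_forall fun _ => norm_nonneg _) ?_ hlim
  filter_upwards [Filter.eventually_ge_atTop k₀] with K hK
  have hA := le_sum_range_of_one_le hA1 (K + 1)
  have hK0 : (0 : ℝ) < ((K + 1 : ℕ) : ℝ) := by positivity
  have hpos := lt_of_lt_of_le hK0 hA
  have h1 := hconst (K + 1 - k₀)
  rw [show k₀ + (K + 1 - k₀) = K + 1 by omega] at h1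
  have h2 : (∑ k ∈ Finset.range (K + 1), c k) / ∑ k ∈ Finset.range (K + 1), A k - θ =
      (s k₀ - φ (K + 1)) / ∑ k ∈ Finset.range (K + 1), A k := by
    rw [← h1, div_sub' hpos.ne']
    congr 1
    simp only [hs]; ring
  rw [h2, norm_div, Real.norm_eq_abs, Real.norm_eq_abs, abs_of_pos hpos, div_eq_mul_one_div]
  push_cast at hA hK0
  refine mul_le_mul ((abs_sub _ _).trans (by linarith [hB (K + 1)]))
    (one_div_le_one_div_of_le hK0 hA) (by positivity) ?_
  linarith [abs_nonneg (s k₀), (abs_nonneg _).trans (hB 0)]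

end Sequences

variable {S} {i m : Fin N} {π : ℕ → Fin N} {lam θ : ℝ} {h : ℕ → ℝ}

theorem le_averageCost (hm : m ≠ i) (hπ : π ∈ twoActionPolicies i m)
    (hh : S.IsRelativeValue lam θ i m h) (v₀ : ℕ) :
    (θ : EReal) ≤ S.averageCost lam i π v₀ := by
  by_contra hcon
  rw [not_le] at hcon
  obtain ⟨r, hr1, hr2⟩ := EReal.lt_iff_exists_real_btwn.1 hcon
  have hr2 : r < θ := by exact_mod_cast hr2
  obtain ⟨C, hC0, hC⟩ := LinearGrowth.nonneg_bound hh.2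
  have hα := S.α_pos i
  have hfreq := frequently_lt_sum_div_sum (fun k => hh.expect_le hm hπ v₀ k)
    (one_le_expect_meanDuration hπ v₀) (expect_meanDuration_le hπ v₀)
    (C := C + 1) (a := S.meanAge i π v₀) (by linarith)
    (fun k => expect_le_affine hπ v₀ k hh.2 fun v => by
      have := (le_abs_self _).trans (hC v)
      have hv : (0 : ℝ) ≤ v := v.cast_nonneg
      nlinarith)
    hα (d := -|lam * S.L i|)
    (fun k => affine_le_expect hπ v₀ k (S.linearGrowth_stageCost_policy hπ lam) fun v => by
      have hL : (1 : ℝ) ≤ S.L (π v) := by exact_mod_cast S.one_le_L _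
      have hw : 0 ≤ S.w (π v) := by
        have := S.p_pos
        have : 0 ≤ (S.L (π v) : ℝ) - 1 := by linarith
        rw [w]; positivity
      have hv : (0 : ℝ) ≤ v := v.cast_nonneg
      have h1 : S.α i * v ≤ S.g i (π v) v := by
        rw [g]
        refine mul_le_mul_of_nonneg_left ?_ hα.le
        nlinarith
      rw [stageCost, ageCost_eq, meanDuration_eq]
      split_ifs
      · linarith [neg_abs_le (lam * S.L i)]
      · linarith [abs_nonneg (lam * S.L i)]) hr2
  have hev := Filter.eventually_lt_of_limsup_lt hr1
  obtain ⟨K, hK1, hK2⟩ := (hfreq.and_eventually hev).exists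
  have hK2 : S.costRatio lam i π v₀ K < r := by exact_mod_cast hK2
  exact lt_asymm hK1 hK2

theorem tendsto_costRatio (hm : m ≠ i) (hπ : π ∈ twoActionPolicies i m)
    (hh : S.IsRelativeValue lam θ i m h)
    (hopt : ∀ v, S.L i ≤ v → (π v = i ∧ S.QSelf lam θ h i v ≤ S.QOther θ h i m v) ∨
      (π v = m ∧ S.QOther θ h i m v ≤ S.QSelf lam θ h i v))
    {V : ℕ} (hV : ∀ v, V ≤ v → π v = i) (v₀ : ℕ) :
    Filter.Tendsto (fun K => S.costRatio lam i π v₀ K) Filter.atTop (nhds θ) := by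
  obtain ⟨C, hC0, hC⟩ := LinearGrowth.nonneg_bound hh.2
  obtain ⟨B, hB⟩ := S.meanAge_bounded hm hπ hV v₀
  refine tendsto_sum_div_sum (B := C * B + C) (fun k hk => hh.expect_eq hm hπ hopt v₀ hk)
    (one_le_expect_meanDuration hπ v₀) fun k => ?_
  have h1 := expect_le_affine (S := S) hπ v₀ k hh.2 (a := C) (b := C)
    fun v => by linarith [(le_abs_self _).trans (hC v)]
  have h2 := affine_le_expect (S := S) hπ v₀ k hh.2 (a := -C) (b := -C)
    fun v => by linarith [neg_le_of_abs_le (hC v)]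
  have h3 := mul_le_mul_of_nonneg_left (hB k) hC0
  rw [abs_le]
  constructor <;> linarith

end UpdateSystem

theorem mainTheorem1 {N : ℕ} (S : UpdateSystem N) (i m : Fin N) (hm : m ≠ i) (lam : ℝ) :
    ∃ (θ : ℝ) (T : ℕ),
      (∀ v₀ : ℕ, S.optimalCost lam i m v₀ = (θ : EReal)) ∧
      (T : ℤ) = max 0 ⌈θ / S.α i - ((S.L m : ℝ) - 1) / (2 * S.p) - (S.L i : ℝ) / S.p⌉ ∧
      (∃ h : ℕ → ℝ, S.IsRelativeValue lam θ i m h) ∧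
      (∀ h : ℕ → ℝ, S.IsRelativeValue lam θ i m h → ∀ v : ℕ, S.L i ≤ v →
        (v < T → S.QOther θ h i m v < S.QSelf lam θ h i v) ∧
        (T ≤ v → S.QSelf lam θ h i v ≤ S.QOther θ h i m v)) ∧
      (∀ π ∈ UpdateSystem.twoActionPolicies i m,
        (∀ v : ℕ, S.L i ≤ v → π v = if v < T then m else i) →
        ∀ v₀ : ℕ, S.averageCost lam i π v₀ = S.optimalCost lam i m v₀ ∧
          Filter.Tendsto (fun K => S.costRatio lam i π v₀ K) Filter.atTop (nhds θ)) := by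
  obtain ⟨θ, h, hh⟩ := S.exists_isRelativeValue i m lam
  obtain ⟨T, hT⟩ : ∃ T : ℕ, (T : ℤ) = max 0 ⌈S.indifferenceAge θ i m⌉ :=
    ⟨_, Int.toNat_of_nonneg (le_max_left _ _)⟩
  have hlt : ∀ v : ℕ, v < T → (v : ℝ) < S.indifferenceAge θ i m := by
    intro v hv
    have h1 : (v : ℤ) < ⌈S.indifferenceAge θ i m⌉ := by omega
    exact_mod_cast Int.lt_ceil.1 h1
  have hge : ∀ v : ℕ, T ≤ v → S.indifferenceAge θ i m ≤ v := by
    intro v hv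
    have h1 : ⌈S.indifferenceAge θ i m⌉ ≤ (v : ℤ) := by omega
    exact_mod_cast Int.ceil_le.1 h1
  have hlim : ∀ π ∈ UpdateSystem.twoActionPolicies i m,
      (∀ v : ℕ, S.L i ≤ v → π v = if v < T then m else i) → ∀ v₀ : ℕ,
      Filter.Tendsto (fun K => S.costRatio lam i π v₀ K) Filter.atTop (nhds θ) := by
    intro π hπ hπT v₀
    refine UpdateSystem.tendsto_costRatio hm hπ hh (fun v hv => ?_) (V := S.L i + T)
      (fun v hv => ?_) v₀
    · rw [hπT v hv]
      by_cases hvT : v < T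
      · exact Or.inr ⟨if_pos hvT, ((hh.threshold v).1 (hlt v hvT)).le⟩
      · exact Or.inl ⟨if_neg hvT, (hh.threshold v).2 (hge v (not_lt.1 hvT))⟩
    · rw [hπT v (by omega), if_neg (by omega)]
  have havg : ∀ π ∈ UpdateSystem.twoActionPolicies i m,
      (∀ v : ℕ, S.L i ≤ v → π v = if v < T then m else i) → ∀ v₀ : ℕ,
      S.averageCost lam i π v₀ = θ := fun π hπ hπT v₀ =>
    ((continuous_coe_real_ereal.tendsto θ).comp (hlim π hπ hπT v₀)).limsup_eq
  have hopt : ∀ v₀ : ℕ, S.optimalCost lam i m v₀ = (θ : EReal) := by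
    intro v₀
    refine le_antisymm ?_ (le_iInf₂ fun π hπ => UpdateSystem.le_averageCost hm hπ hh v₀)
    have hmem : (fun v => if v < T then m else i) ∈ UpdateSystem.twoActionPolicies i m := by
      intro v
      by_cases hv : v < T <;> simp [hv]
    rw [← havg _ hmem (fun _ _ => rfl) v₀]
    exact iInf₂_le _ hmem
  exact ⟨θ, T, hopt, hT, ⟨h, hh⟩, fun h' hh' v _ =>
    ⟨fun hv => (hh'.threshold v).1 (hlt v hv), fun hv => (hh'.threshold v).2 (hge v hv)⟩,
    fun π hπ hπT v₀ => ⟨(havg π hπ hπT v₀).trans (hopt v₀).symm, hlim π hπ hπT v₀⟩⟩
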